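/- Let $k$ be an algebraically closed field of characteristic $p>0$ and let $X\to\mathbb P^1$ be a Harbater–Katz–Gabber cover over $k$ whose Galois group $G$ is a $p$-group: $X$ is a complete non-singular curve, $X\to\mathbb P^1$ is a Galois cover with group $G$, a point $P\in X$ is totally ramified, and all other points of $X$ are unramified over $\mathbb P^1$. Let $F$ be the function field of $X$ and $g=\dim_k H^0(X,\Omega_X)$ its genus. Let $f_0,\dots,f_r\in F$ have no pole outside $P$ and be such that $k(f_0)=F^{G}$ is the function field of $\mathbb P^1$ and $F=k(f_0,\dots,f_r)$ (so $F$ is obtained by the tower $F_1=k(f_0)$, $F_{i+1}=F_i(f_i)$). Let $\bar m_\nu$ be the pole order of $f_\nu$ at $P$, and let $|G_0|=|G|$ be the order of the inertia group $G_0$ at $P$ (this is also the pole order of $f_0$ at $P$). Put $$\mathbf A=\Big\{L=(i_0,\dots,i_r)\in\mathbb N^{r+1}:\ i_0|G_0|+\sum_{\nu=1}^r i_\nu\bar m_\nu\le 2g-2\Big\},$$ and, for $L=(i_0,\dots,i_r)$, $f_L=f_0^{i_0}\cdots f_r^{i_r}$ and $\omega_L=f_L\,df_0$. Then $\omega_L\in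 H^0(X,\Omega_X)$ for every $L\in\mathbf A$, and the set $$G_0^{\mathrm{bin}}=\{\omega_L\omega_K-\omega_{L'}\omega_{K'}\in \mathrm{Sym}\,H^0(X,\Omega_X):\ L,K,L',K'\in\mathbf A,\ L+K=L'+K'\}$$ is contained in the canonical ideal, that is, in the kernel of the canonical map $$\phi:\mathrm{Sym}\,H^0(X,\Omega_X)\to\bigoplus_{n\ge0}H^0(X,\Omega_X^{\otimes n}).$$ -/

import Mathlib

open scoped KaehlerDifferential DirectSum IntermediateField

noncomputable section

namespace HKG

/-! ### Curves through their function fields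

A complete non-singular curve `X` over an algebraically closed field `k` is given by its function
field `F / k`.  Its closed points are the non-trivial valuation rings of `F` containing `k`, and
these are the local rings of `X`. -/

section Curve

variable (k F : Type*) [Field k] [Field F] [Algebra k F]

/-- `O` is the local ring of a closed point of the curve with function field `F / k`. -/
def IsPlace {F : Type*} [Field F] [Algebra k F] (O : ValuationSubring F) : Prop :=
  (∀ c : k, algebraMap k F c ∈ O) ∧ O ≠ ⊤

/-- The stalk at `O` of the sheaf `Ω_X`, inside the module `Ω[F⁄k]` of rational differentials:
the `O`-submodule generated by the differentials `da`, `a ∈ O`. -/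
def regularDifferentialsAt {F : Type*} [Field F] [Algebra k F] (O : ValuationSubring F) :
    AddSubgroup Ω[F⁄k] :=
  AddSubgroup.closure {η | ∃ c ∈ O, ∃ a ∈ O, η = c • KaehlerDifferential.D k F a}

/-- The stalk at `O` of `Ω_X^{⊗n}`, inside the `n`-th tensor power over `F` of `Ω[F⁄k]`
(the degree `n` part of the tensor algebra): the `O`-submodule generated by the
`da₁ ⊗ ⋯ ⊗ daₙ`, `aᵢ ∈ O`. -/
def regularPolydifferentialsAt {F : Type*} [Field F] [Algebra k F] (n : ℕ)
    (O : ValuationSubring F) : AddSubgroup (TensorAlgebra F Ω[F⁄k]) :=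
  AddSubgroup.closure {η | ∃ c ∈ O, ∃ a : Fin n → F, (∀ i, a i ∈ O) ∧
    η = c • TensorAlgebra.tprod F Ω[F⁄k] n (fun i => KaehlerDifferential.D k F (a i))}

variable {k F}

theorem smul_mem_regularDifferentialsAt {O : ValuationSubring F} {c : F} (hc : c ∈ O)
    {η : Ω[F⁄k]} (hη : η ∈ regularDifferentialsAt k O) :
    c • η ∈ regularDifferentialsAt k O := by
  unfold regularDifferentialsAt at hη ⊢
  induction hη using AddSubgroup.closure_induction with
  | mem x hx =>
    obtain ⟨d, hd, a, ha, rfl⟩ := hx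
    exact AddSubgroup.subset_closure ⟨c * d, O.mul_mem _ _ hc hd, a, ha, by rw [mul_smul]⟩
  | zero => simp
  | add x y _ _ hx hy => rw [smul_add]; exact add_mem hx hy
  | neg x _ hx => rw [smul_neg]; exact neg_mem hx

theorem smul_mem_regularPolydifferentialsAt {n : ℕ} {O : ValuationSubring F} {c : F} (hc : c ∈ O)
    {η : TensorAlgebra F Ω[F⁄k]} (hη : η ∈ regularPolydifferentialsAt k n O) :
    c • η ∈ regularPolydifferentialsAt k n O := by
  unfold regularPolydifferentialsAt at hη ⊢
  induction hη using AddSubgroup.closure_induction with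
  | mem x hx =>
    obtain ⟨d, hd, a, ha, rfl⟩ := hx
    exact AddSubgroup.subset_closure ⟨c * d, O.mul_mem _ _ hc hd, a, ha, by rw [mul_smul]⟩
  | zero => simp
  | add x y _ _ hx hy => rw [smul_add]; exact add_mem hx hy
  | neg x _ hx => rw [smul_neg]; exact neg_mem hx

theorem ι_mem_regularPolydifferentialsAt {O : ValuationSubring F}
    {η : Ω[F⁄k]} (hη : η ∈ regularDifferentialsAt k O) :
    TensorAlgebra.ι F η ∈ regularPolydifferentialsAt k 1 O := by
  unfold regularDifferentialsAt at hη
  unfold regularPolydifferentialsAt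
  induction hη using AddSubgroup.closure_induction with
  | mem x hx =>
    obtain ⟨d, hd, a, ha, rfl⟩ := hx
    exact AddSubgroup.subset_closure ⟨d, hd, fun _ => a, fun _ => ha, by simp⟩
  | zero => simp
  | add x y _ _ hx hy => rw [map_add]; exact add_mem hx hy
  | neg x _ hx => rw [map_neg]; exact neg_mem hx

theorem one_mem_regularPolydifferentialsAt (O : ValuationSubring F) :
    (1 : TensorAlgebra F Ω[F⁄k]) ∈ regularPolydifferentialsAt k 0 O :=
  AddSubgroup.subset_closure ⟨1, O.one_mem, Fin.elim0, fun i => i.elim0, by simp⟩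

theorem mul_mem_regularPolydifferentialsAt {m n : ℕ} {O : ValuationSubring F}
    {η θ : TensorAlgebra F Ω[F⁄k]} (hη : η ∈ regularPolydifferentialsAt k m O)
    (hθ : θ ∈ regularPolydifferentialsAt k n O) :
    η * θ ∈ regularPolydifferentialsAt k (m + n) O := by
  unfold regularPolydifferentialsAt at hη hθ ⊢
  induction hη using AddSubgroup.closure_induction with
  | zero => simp
  | add x y _ _ hx hy => rw [add_mul]; exact add_mem hx hy
  | neg x _ hx => rw [neg_mul]; exact neg_mem hx
  | mem x hx =>
    obtain ⟨c, hc, a, ha, rfl⟩ := hx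
    induction hθ using AddSubgroup.closure_induction with
    | zero => simp
    | add x y _ _ hx hy => rw [mul_add]; exact add_mem hx hy
    | neg x _ hx => rw [mul_neg]; exact neg_mem hx
    | mem y hy =>
      obtain ⟨d, hd, b, hb, rfl⟩ := hy
      refine AddSubgroup.subset_closure
        ⟨c * d, O.mul_mem _ _ hc hd, Fin.append a b, fun i => ?_, ?_⟩
      · refine Fin.addCases (fun i => ?_) (fun i => ?_) i
        · simpa using ha i
        · simpa using hb i
      · have : (fun i => TensorAlgebra.ι F (KaehlerDifferential.D k F (Fin.append a b i)))
            = Fin.append (fun i => TensorAlgebra.ι F (KaehlerDifferential.D k F (a i)))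
                (fun i => TensorAlgebra.ι F (KaehlerDifferential.D k F (b i))) := by
          funext i
          refine Fin.addCases (fun i => ?_) (fun i => ?_) i <;> simp
        rw [TensorAlgebra.tprod_apply, TensorAlgebra.tprod_apply, TensorAlgebra.tprod_apply, this,
          List.ofFn_fin_append, List.prod_append, smul_mul_smul_comm]

variable (k F)

/-- `H⁰(X, Ω_X)`: the rational differentials that are regular at every point. -/
def holomorphicDifferentials : Submodule k Ω[F⁄k] where
  carrier := {η | ∀ O : ValuationSubring F, IsPlace k O → η ∈ regularDifferentialsAt k O}
  zero_mem' := fun _ _ => zero_mem _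
  add_mem' := fun hx hy O hO => add_mem (hx O hO) (hy O hO)
  smul_mem' := fun c x hx O hO => by
    rw [← algebraMap_smul F c x]
    exact smul_mem_regularDifferentialsAt (hO.1 c) (hx O hO)

/-- `H⁰(X, Ω_X^{⊗n})`: the rational `n`-differentials that are regular at every point. -/
def holomorphicPolydifferentials (n : ℕ) : Submodule k (TensorAlgebra F Ω[F⁄k]) where
  carrier := {η | η ∈ LinearMap.range (TensorAlgebra.ι F : Ω[F⁄k] →ₗ[F] _) ^ n ∧
    ∀ O : ValuationSubring F, IsPlace k O → η ∈ regularPolydifferentialsAt k n O}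
  zero_mem' := ⟨zero_mem _, fun _ _ => zero_mem _⟩
  add_mem' := fun hx hy => ⟨add_mem hx.1 hy.1, fun O hO => add_mem (hx.2 O hO) (hy.2 O hO)⟩
  smul_mem' := fun c x hx => by
    rw [← algebraMap_smul F c x]
    exact ⟨Submodule.smul_mem _ _ hx.1,
      fun O hO => smul_mem_regularPolydifferentialsAt (hO.1 c) (hx.2 O hO)⟩

instance : SetLike.GradedMonoid (holomorphicPolydifferentials k F) where
  one_mem := ⟨by rw [pow_zero]; exact Submodule.one_le.mp le_rfl,
    fun O _ => one_mem_regularPolydifferentialsAt O⟩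
  mul_mem := fun _ _ _ _ hx hy => ⟨by rw [pow_add]; exact Submodule.mul_mem_mul hx.1 hy.1,
    fun O hO => mul_mem_regularPolydifferentialsAt (hx.2 O hO) (hy.2 O hO)⟩

/-- The genus `g = dim_k H⁰(X, Ω_X)`. -/
def genus : ℕ := Module.finrank k (holomorphicDifferentials k F)

/-- The identification of a holomorphic differential with a tensor of degree one. -/
def toPolydifferentials :
    holomorphicDifferentials k F →ₗ[k] holomorphicPolydifferentials k F 1 where
  toFun η := ⟨TensorAlgebra.ι F (η : Ω[F⁄k]),
    by rw [pow_one]; exact LinearMap.mem_range_self _ _,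
    fun O hO => ι_mem_regularPolydifferentialsAt (η.2 O hO)⟩
  map_add' x y := Subtype.ext (by simp)
  map_smul' c x := Subtype.ext (by
    simp only [Submodule.coe_smul, RingHom.id_apply]
    rw [← algebraMap_smul F c (x : Ω[F⁄k]), map_smul, algebraMap_smul])

variable {k F}

/-- If `Ω[F⁄k]` has rank at most one, then its tensor algebra is commutative. -/
theorem tensorAlgebra_mul_comm (h : Module.rank F Ω[F⁄k] ≤ 1)
    (x y : TensorAlgebra F Ω[F⁄k]) : x * y = y * x := by
  obtain ⟨w, hw⟩ := rank_le_one_iff.mp h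
  change Commute x y
  induction y using TensorAlgebra.induction with
  | algebraMap r => exact Algebra.commute_algebraMap_right _ _
  | mul a b ha hb => exact ha.mul_right hb
  | add a b ha hb => exact ha.add_right hb
  | ι v =>
    induction x using TensorAlgebra.induction with
    | algebraMap r => exact Algebra.commute_algebraMap_left _ _
    | mul a b ha hb => exact ha.mul_left hb
    | add a b ha hb => exact ha.add_left hb
    | ι u =>
      obtain ⟨a, rfl⟩ := hw u
      obtain ⟨b, rfl⟩ := hw v
      rw [map_smul, map_smul]
      exact ((Commute.refl _).smul_left a).smul_right b

theorem directSum_mul_comm (h : Module.rank F Ω[F⁄k] ≤ 1)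
    (x y : ⨁ n, holomorphicPolydifferentials k F n) : x * y = y * x := by
  change Commute x y
  induction x using DirectSum.induction_on with
  | zero => exact Commute.zero_left _
  | add a b ha hb => exact ha.add_left hb
  | of i a =>
    induction y using DirectSum.induction_on with
    | zero => exact Commute.zero_right _
    | add a b ha hb => exact ha.add_right hb
    | of j b =>
      change _ * _ = _ * _
      rw [DirectSum.of_mul_of, DirectSum.of_mul_of]
      exact DirectSum.of_eq_of_gradedMonoid_eq
        (Sigma.subtype_ext (add_comm i j) (tensorAlgebra_mul_comm h a b))

/-- The canonical map `Sym H⁰(X, Ω_X) → ⨁ₙ H⁰(X, Ω_X^{⊗n})`, i.e. the homomorphism of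
`k`-algebras that is the identity in degree one.  (Since `F` is the function field of a curve,
`Ω[F⁄k]` is one-dimensional; this makes the target commutative.) -/
def canonicalMap (h : Module.rank F Ω[F⁄k] ≤ 1) :
    SymmetricAlgebra k (holomorphicDifferentials k F) →ₐ[k]
      ⨁ n, holomorphicPolydifferentials k F n :=
  letI : CommSemiring (⨁ n, holomorphicPolydifferentials k F n) :=
    { (inferInstance : Semiring (⨁ n, holomorphicPolydifferentials k F n)) with
      mul_comm := directSum_mul_comm h }
  SymmetricAlgebra.lift
    ((DirectSum.lof k ℕ (fun n => holomorphicPolydifferentials k F n) 1).comp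
      (toPolydifferentials k F))

theorem canonicalMap_ι (h : Module.rank F Ω[F⁄k] ≤ 1) (η : holomorphicDifferentials k F) :
    canonicalMap h (SymmetricAlgebra.ι k _ η) =
      DirectSum.of (fun n => holomorphicPolydifferentials k F n) 1
        (toPolydifferentials k F η) := by
  let _ : CommSemiring (⨁ n, holomorphicPolydifferentials k F n) :=
    { (inferInstance : Semiring (⨁ n, holomorphicPolydifferentials k F n)) with
      mul_comm := directSum_mul_comm h }
  exact SymmetricAlgebra.lift_ι_apply _ η

/-- The canonical ideal of the curve: the kernel of the canonical map. -/
def canonicalIdeal (h : Module.rank F Ω[F⁄k] ≤ 1) :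
    Ideal (SymmetricAlgebra k (holomorphicDifferentials k F)) :=
  RingHom.ker (canonicalMap h)

/-- The pole order at `P` of a function: the least `n` with `𝔪_P ^ n • a ⊆ O_P`. -/
def poleOrder (P : ValuationSubring F) (a : F) : ℕ :=
  sInf {n | ∀ t ∈ IsLocalRing.maximalIdeal P ^ n, (t : F) * a ∈ P}

/-- The place `O` has ramification index `e` over the subfield `E`, i.e. `𝔪_Q O = 𝔪_O ^ e`, where
`Q = O ∩ E` is the place of `E` below `O`, so that `𝔪_Q = 𝔪_O ∩ E`. -/
def HasRamificationIndex (E : IntermediateField k F) (O : ValuationSubring F) (e : ℕ) : Prop :=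
  Ideal.span {a : O | (a : F) ∈ E ∧ a ∈ IsLocalRing.maximalIdeal O} =
    IsLocalRing.maximalIdeal O ^ e

end Curve

/-! ### Harbater–Katz–Gabber covers -/

section Cover

variable {k F : Type*} [Field k] [Field F] [Algebra k F] {r : ℕ}

/-- The functions `f₀, …, f_r` generate the function field of an HKG-cover `X → ℙ¹` with Galois
group a `p`-group, ramified at `P` only.  The line `ℙ¹` has function field `k(f₀)`, and
`F_{i+1} = F_i(f_i)` is the tower of intermediate fields, from `F₁ = k(f₀)` up to
`F_{r+1} = F`. -/
structure IsHKGCover (p : ℕ) (P : ValuationSubring F) (f : Fin (r + 1) → F) : Prop where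
  isPlace : IsPlace k P
  transcendental : Transcendental k (f 0)
  finite : FiniteDimensional k⟮f 0⟯ F
  isGalois : IsGalois k⟮f 0⟯ F
  isPGroup : IsPGroup p Gal(F/k⟮f 0⟯)
  /-- `P` is totally ramified over `ℙ¹`. -/
  totally_ramified : HasRamificationIndex k⟮f 0⟯ P (Module.finrank k⟮f 0⟯ F)
  /-- All other points are unramified over `ℙ¹`. -/
  unramified : ∀ O : ValuationSubring F, IsPlace k O → O ≠ P →
    HasRamificationIndex k⟮f 0⟯ O 1
  /-- The `f_i` have no pole outside `P`. -/
  regular : ∀ i, ∀ O : ValuationSubring F, IsPlace k O → O ≠ P → f i ∈ O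
  adjoin_eq_top : IntermediateField.adjoin k (Set.range f) = ⊤

/-- The differentials of the function field of an HKG-cover are one-dimensional. -/
theorem IsHKGCover.rank_le_one {p : ℕ} {P : ValuationSubring F} {f : Fin (r + 1) → F}
    (hX : IsHKGCover (k := k) p P f) : Module.rank F Ω[F⁄k] ≤ 1 := by
  have := hX.isGalois
  set W : Submodule F Ω[F⁄k] := F ∙ KaehlerDifferential.D k F (f 0)
  let d : Derivation k F (Ω[F⁄k] ⧸ W) := W.mkQ.compDer (KaehlerDifferential.D k F)
  have hd0 : ∀ e ∈ k⟮f 0⟯, d e = 0 := by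
    intro e he
    induction he using IntermediateField.adjoin_induction with
    | mem x hx =>
      obtain rfl : x = f 0 := hx
      exact (Submodule.Quotient.mk_eq_zero W).mpr (Submodule.mem_span_singleton_self _)
    | algebraMap c => exact d.map_algebraMap c
    | add x y _ _ hx hy => rw [map_add, hx, hy, add_zero]
    | mul x y _ _ hx hy => rw [d.leibniz, hx, hy, smul_zero, smul_zero, add_zero]
    | inv x _ hx =>
      rw [Derivation.leibniz_inv, hx, smul_zero]
  let d' : Derivation k⟮f 0⟯ F (Ω[F⁄k] ⧸ W) :=
    { toFun := d
      map_add' := d.map_add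
      map_smul' := fun c x => by
        rw [Algebra.smul_def, d.leibniz, show d (algebraMap k⟮f 0⟯ F c) = 0 from hd0 _ c.2, smul_zero, add_zero, RingHom.id_apply,
          algebraMap_smul]
      map_one_eq_zero' := d.map_one_eq_zero
      leibniz' := d.leibniz }
  have : Algebra.FormallyUnramified k⟮f 0⟯ F := Algebra.FormallyUnramified.of_isSeparable _ _
  have hd' : d' = 0 := by
    rw [← d'.liftKaehlerDifferential_comp,
      Subsingleton.elim d'.liftKaehlerDifferential 0]
    ext
    simp
  have hW : ∀ η : Ω[F⁄k], η ∈ W := by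
    intro η
    have hη : η ∈ Submodule.span F (Set.range (KaehlerDifferential.D k F)) := by
      rw [KaehlerDifferential.span_range_derivation]; trivial
    refine Submodule.span_le.mpr ?_ hη
    rintro _ ⟨x, rfl⟩
    exact (Submodule.Quotient.mk_eq_zero W).mp (congrArg (fun D => D x) hd')
  exact rank_le_one_iff.mpr ⟨_, fun η => Submodule.mem_span_singleton.mp (hW η)⟩

/-- `‖L‖ = i₀ |G₀| + ∑_ν i_ν m̄_ν`, where `G₀` is the inertia group at `P`, which is the whole
Galois group, and `m̄_ν` is the pole order of `f_ν` at `P`. -/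
def norm (k : Type*) {F : Type*} [Field k] [Field F] [Algebra k F]
    (P : ValuationSubring F) (f : Fin (r + 1) → F) (L : Fin (r + 1) → ℕ) : ℕ :=
  L 0 * Nat.card Gal(F/k⟮f 0⟯) + ∑ ν : Fin r, L ν.succ * poleOrder P (f ν.succ)

/-- The set `𝐀` of all `L ∈ ℕ^{r+1}` with `‖L‖ ≤ 2g - 2`. -/
def indexSet (k : Type*) {F : Type*} [Field k] [Field F] [Algebra k F]
    (P : ValuationSubring F) (f : Fin (r + 1) → F) : Set (Fin (r + 1) → ℕ) :=
  {L | (norm k P f L : ℤ) ≤ 2 * (genus k F : ℤ) - 2}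

/-- `ω_L = f_L df₀`, where `f_L = f₀^{i₀} ⋯ f_r^{i_r}`. -/
def omega (k : Type*) {F : Type*} [Field k] [Field F] [Algebra k F]
    (f : Fin (r + 1) → F) (L : Fin (r + 1) → ℕ) : Ω[F⁄k] :=
  (∏ i, f i ^ L i) • KaehlerDifferential.D k F (f 0)

/-- The set `G₀` of binomials `ω_L ω_K - ω_{L'} ω_{K'}` in `Sym H⁰(X, Ω_X)` with
`L + K = L' + K'` and `L, K, L', K' ∈ 𝐀`, the `ω_L` being holomorphic by `h`. -/
def binomials {P : ValuationSubring F} {f : Fin (r + 1) → F}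
    (h : ∀ L ∈ indexSet k P f, omega k f L ∈ holomorphicDifferentials k F) :
    Set (SymmetricAlgebra k (holomorphicDifferentials k F)) :=
  {b | ∃ L K L' K' : indexSet k P f, (L + K : Fin (r + 1) → ℕ) = L' + K' ∧
    b = SymmetricAlgebra.ι k _ ⟨omega k f L, h L L.2⟩ * SymmetricAlgebra.ι k _ ⟨omega k f K, h K K.2⟩
      - SymmetricAlgebra.ι k _ ⟨omega k f L', h L' L'.2⟩ *
        SymmetricAlgebra.ι k _ ⟨omega k f K', h K' K'.2⟩}

end Cover

end HKG

end

/-! The binomials cause no difficulty once every `ω_L` is holomorphic: `ω_L ω_K` is `f_{L+K}` times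
the square of `df₀`, so it depends on `L + K` only. The work lies in the holomorphy.

Away from `P` both `f_L` and `f₀` are regular. At `P`, let `d` be the order of vanishing of `df₀`;
then `f_L df₀` is regular as soon as the pole order of `f_L` is at most `d`. Since `‖L‖` bounds that
pole order, what is needed is `2g - 2 ≤ d` (`genus_le`), one half of the degree formula for the
canonical divisor `d · P`.

This is obtained without Riemann–Roch. The cover is unramified outside `P`, so division by `df₀`
embeds `H⁰(X, Ω_X)` into the functions regular outside `P` with pole order at most `d` at `P`. Pole
orders add under multiplication. If `d + 1` is not a pole order, then `s` and `d + 1 - s` are never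
both pole orders, so at most half of `0, …, d + 1` occur and `2g ≤ d + 2` (`two_mul_finrank_le`).

That `d + 1` is not a pole order is a case of the residue theorem: no differential `w df₀` has a
simple pole at `P` as its only pole (`valuation_mul_ne`). Total ramification allows a proof by
traces. By Euler's formula and the computation of the different at `P`, the trace of such a `w` to
`k(f₀)` would have the valuation of `1 / f₀`; it would then be regular everywhere, vanish at `P` and
yet be nonzero.

Valuations are written multiplicatively: a smaller value means a higher order of vanishing. -/

noncomputable section

namespace HKG

/-! ### Places above an affine Dedekind model -/

section DedekindModel

variable {B F : Type*} [CommRing B] [Field F] [Algebra B F]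

/-- A non-trivial valuation ring containing a Dedekind domain with the same fraction field is
a localization at a non-zero prime. -/
theorem exists_prime_of_range_le [IsDedekindDomain B] [IsFractionRing B F]
    (O : ValuationSubring F) (hO : O ≠ ⊤) (hB : ∀ b : B, algebraMap B F b ∈ O) :
    IsDiscreteValuationRing O ∧
      ∀ a ∈ O, ∃ b s : B, O.valuation (algebraMap B F s) = 1 ∧
        a * algebraMap B F s = algebraMap B F b := by
  let j : B →+* O := (algebraMap B F).codRestrict O.toSubring hB
  let : Algebra B O := j.toAlgebra
  let 𝔪 : Ideal B := (IsLocalRing.maximalIdeal O).comap j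
  have hmem : ∀ b : B, b ∈ 𝔪 ↔ O.valuation (algebraMap B F b) < 1 := fun b =>
    O.valuation_lt_one_iff (j b)
  have hle : ∀ b : B, O.valuation (algebraMap B F b) ≤ 1 := fun b => O.valuation_le_one (j b)
  have hone : ∀ b : B, b ∉ 𝔪 → O.valuation (algebraMap B F b) = 1 := fun b hb =>
    le_antisymm (hle b) (not_lt.mp fun h => hb ((hmem b).mpr h))
  have hinj : Function.Injective (algebraMap B F) := IsFractionRing.injective B F
  have hbot : 𝔪 ≠ ⊥ := by
    intro h
    apply hO
    refine top_le_iff.mp fun a _ => ?_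
    obtain ⟨b, s, hs, rfl⟩ := IsFractionRing.div_surjective (A := B) a
    have hs0 : s ∉ 𝔪 := by
      rw [h]; exact nonZeroDivisors.ne_zero hs
    refine (O.valuation_le_one_iff _).mp ?_
    rw [map_div₀, hone s hs0, div_one]
    exact hle b
  have hfrac : ∀ a ∈ O, ∃ b s : B, s ∉ 𝔪 ∧ a * algebraMap B F s = algebraMap B F b := by
    intro a ha
    obtain ⟨b, s, hs, rfl⟩ := IsFractionRing.div_surjective (A := B) a
    have hs0 : algebraMap B F s ≠ 0 := by
      rw [Ne, map_eq_zero_iff _ hinj]; exact nonZeroDivisors.ne_zero hs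
    -- In the valuation ring `B_𝔪` one of `b`, `s` divides the other. If `s ∣ b`, the fraction
    -- acquires a denominator outside `𝔪`. If `b ∣ s`, then `b / s = u / c` with `u ∉ 𝔪`, and `c ∈
    -- 𝔪` would make `u = (b / s) c` a non-unit of `O`.
    let L := Localization.AtPrime 𝔪
    have := IsLocalization.AtPrime.isDiscreteValuationRing_of_dedekind_domain B hbot L
    have hL : Function.Injective (algebraMap B L) :=
      IsLocalization.injective L 𝔪.primeCompl_le_nonZeroDivisors
    have key : ∀ b s : B, algebraMap B L s ∣ algebraMap B L b → ∃ c u : B, u ∉ 𝔪 ∧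
        s * c = u * b := by
      rintro b s ⟨q, hq⟩
      obtain ⟨⟨c, u⟩, hcu⟩ := IsLocalization.surj 𝔪.primeCompl q
      refine ⟨c, u, u.2, hL ?_⟩
      rw [map_mul, map_mul, hq, ← hcu]
      ring
    rcases ValuationRing.dvd_total (algebraMap B L s) (algebraMap B L b) with h | h
    · obtain ⟨c, u, hu, h⟩ := key _ _ h
      refine ⟨c, u, hu, ?_⟩
      have := congrArg (algebraMap B F) h
      rw [map_mul, map_mul] at this
      field_simp
      linear_combination -this
    · obtain ⟨c, u, hu, h⟩ := key _ _ h
      have h' := congrArg (algebraMap B F) h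
      rw [map_mul, map_mul] at h'
      refine ⟨u, c, fun hc => ?_, ?_⟩
      · refine ((hmem u).not.mp hu) ?_
        have : algebraMap B F u = algebraMap B F b / algebraMap B F s * algebraMap B F c := by
          field_simp; linear_combination -h'
        rw [this, map_mul]
        exact lt_of_le_of_lt (mul_le_of_le_one_left' ((O.valuation_le_one_iff _).mpr ha))
          ((hmem c).mp hc)
      · field_simp; linear_combination h'
  refine ⟨?_, fun a ha => ?_⟩
  · have : IsLocalization.AtPrime O 𝔪 := by
      refine ⟨⟨fun s => ?_, fun a => ?_, fun {a b} h => ?_⟩⟩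
      · exact (O.valuation_eq_one_iff (j s)).mpr (hone s s.2)
      · obtain ⟨b, s, hs, h⟩ := hfrac a a.2
        exact ⟨⟨b, s, hs⟩, Subtype.ext h⟩
      · exact ⟨1, by rw [hinj (congrArg Subtype.val h)]⟩
    exact IsLocalization.AtPrime.isDiscreteValuationRing_of_dedekind_domain B hbot O
  · obtain ⟨b, s, hs, h⟩ := hfrac a ha
    exact ⟨b, s, hone s hs, h⟩

variable {k : Type*} [Field k] [Algebra k F] [Algebra k B] [IsScalarTower k B F]

/-- The residue field at a place of a finitely generated algebra over an algebraically closed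
field. -/
theorem exists_valuation_sub_lt_one_of_finiteType [IsAlgClosed k] [Algebra.FiniteType k B]
    [IsDedekindDomain B] [IsFractionRing B F]
    (O : ValuationSubring F) (hO : O ≠ ⊤) (hB : ∀ b : B, algebraMap B F b ∈ O) (b : B) :
    ∃ c : k, O.valuation (algebraMap B F b - algebraMap k F c) < 1 := by
  let j : B →+* O := (algebraMap B F).codRestrict O.toSubring hB
  let 𝔪 : Ideal B := (IsLocalRing.maximalIdeal O).comap j
  have hmem : ∀ b : B, b ∈ 𝔪 ↔ O.valuation (algebraMap B F b) < 1 := fun b =>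
    O.valuation_lt_one_iff (j b)
  have hbot : 𝔪 ≠ ⊥ := by
    intro h
    apply hO
    refine top_le_iff.mp fun a _ => ?_
    obtain ⟨b, s, hs, rfl⟩ := IsFractionRing.div_surjective (A := B) a
    have hs0 : s ∉ 𝔪 := by
      rw [h]; exact nonZeroDivisors.ne_zero hs
    refine (O.valuation_le_one_iff _).mp ?_
    have hs1 : O.valuation (algebraMap B F s) = 1 :=
      le_antisymm (O.valuation_le_one (j s)) (not_lt.mp ((hmem s).not.mp hs0))
    rw [map_div₀, hs1, div_one]
    exact O.valuation_le_one (j b)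
  have hmax : 𝔪.IsMaximal := Ideal.IsPrime.isMaximal (Ideal.comap_isPrime j _) hbot
  let := Ideal.Quotient.field 𝔪
  -- Zariski's lemma: the residue field is finite over the algebraically closed `k`, hence equal to
  -- it.
  have : Module.Finite k (B ⧸ 𝔪) := finite_of_finite_type_of_isJacobsonRing k (B ⧸ 𝔪)
  obtain ⟨c, hc⟩ := (IsAlgClosed.algebraMap_bijective_of_isIntegral (k := k) (K := B ⧸ 𝔪)).2
    (Ideal.Quotient.mk 𝔪 b)
  refine ⟨c, ?_⟩
  have : b - algebraMap k B c ∈ 𝔪 := by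
    rw [← Ideal.Quotient.eq_zero_iff_mem, map_sub, ← hc, sub_eq_zero]
    rfl
  have := (hmem _).mp this
  rwa [map_sub, ← IsScalarTower.algebraMap_apply] at this

/-- The values of a derivation on a finitely generated algebra have a common denominator. -/
theorem exists_denominator_derivation [Algebra.FiniteType k B] [IsDomain B] [IsFractionRing B F]
    (D : Derivation k F F) :
    ∃ s : B, s ≠ 0 ∧ ∀ b : B, ∃ c : B, algebraMap B F s * D (algebraMap B F b) =
      algebraMap B F c := by
  classical
  obtain ⟨T, hT⟩ := (Algebra.FiniteType.out : (⊤ : Subalgebra k B).FG)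
  obtain ⟨s, hs⟩ := IsLocalization.exist_integer_multiples_of_finset (nonZeroDivisors B)
    (T.image fun b => D (algebraMap B F b))
  refine ⟨s, nonZeroDivisors.ne_zero s.2, fun b => ?_⟩
  have hb : b ∈ Algebra.adjoin k (T : Set B) := hT ▸ Algebra.mem_top
  induction hb using Algebra.adjoin_induction with
  | mem b hb =>
    obtain ⟨c, hc⟩ := hs _ (Finset.mem_image_of_mem _ hb)
    exact ⟨c, by rw [hc, Algebra.smul_def]⟩
  | algebraMap c =>
    exact ⟨0, by rw [← IsScalarTower.algebraMap_apply, D.map_algebraMap, mul_zero, map_zero]⟩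
  | add x y _ _ hx hy =>
    obtain ⟨c, hc⟩ := hx
    obtain ⟨d, hd⟩ := hy
    exact ⟨c + d, by rw [map_add, map_add, map_add, ← hc, ← hd, mul_add]⟩
  | mul x y _ _ hx hy =>
    obtain ⟨c, hc⟩ := hx
    obtain ⟨d, hd⟩ := hy
    refine ⟨x * d + y * c, ?_⟩
    rw [map_mul, D.leibniz, map_add, map_mul, map_mul, ← hc, ← hd, smul_eq_mul, smul_eq_mul]
    ring

end DedekindModel

/-! ### Local rings of the curve -/

section Place

variable {k F : Type*} [Field k] [IsAlgClosed k] [Field F] [Algebra k F]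

open IntermediateField.algebraAdjoinAdjoin in
/-- A place at which some transcendental element `y` with `F / k(y)` finite separable is regular:
its ring is a discrete valuation ring with residue field `k`, and derivations of `F` have bounded
poles on it. -/
theorem IsPlace.isDiscreteValuationRing {O : ValuationSubring F} (hO : IsPlace k O) {y : F} (hy : y ∈ O)
    (htr : Transcendental k y) [FiniteDimensional k⟮y⟯ F] [Algebra.IsSeparable k⟮y⟯ F] :
    IsDiscreteValuationRing O ∧
      (∀ a ∈ O, ∃ c : k, O.valuation (a - algebraMap k F c) < 1) ∧
      ∀ D : Derivation k F F, ∃ s : F, s ≠ 0 ∧ ∀ a ∈ O, s * D a ∈ O := by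
  let A := Algebra.adjoin k {y}
  have : IsPrincipalIdealRing A := IsPrincipalIdealRing.of_surjective
    (Polynomial.algEquivOfTranscendental k y htr).toRingEquiv.toRingHom
    (Polynomial.algEquivOfTranscendental k y htr).surjective
  let B := integralClosure A F
  have : IsDedekindDomain B := integralClosure.isDedekindDomain A k⟮y⟯ F
  have : IsFractionRing B F := integralClosure.isFractionRing_of_finite_extension k⟮y⟯ F
  have : Module.Finite A B := IsIntegralClosure.finite A k⟮y⟯ F B
  have : Algebra.FiniteType k A :=
    .of_surjective (Polynomial.algEquivOfTranscendental k y htr).toAlgHom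
      (Polynomial.algEquivOfTranscendental k y htr).surjective
  have : Algebra.FiniteType k B := .trans (S := A) inferInstance inferInstance
  have hA : ∀ a ∈ A, a ∈ O := by
    intro a ha
    induction ha using Algebra.adjoin_induction with
    | mem x hx => obtain rfl : x = y := hx; exact hy
    | algebraMap c => exact hO.1 c
    | add x y _ _ hx hy => exact add_mem hx hy
    | mul x y _ _ hx hy => exact mul_mem hx hy
  have hB : ∀ b : B, algebraMap B F b ∈ O := by
    intro b
    let i : A →+* O := A.val.toRingHom.codRestrict O.toSubring fun a => hA a a.2
    obtain ⟨q, hq, hq0⟩ := b.2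
    have : IsIntegral O (b : F) := ⟨q.map i, hq.map i, by
      rw [Polynomial.eval₂_map]; exact hq0⟩
    obtain ⟨c, hc⟩ := IsIntegrallyClosed.isIntegral_iff.mp this
    rw [show algebraMap B F b = algebraMap O F c from hc.symm]
    exact c.2
  obtain ⟨hdvr, hfrac⟩ := exists_prime_of_range_le O hO.2 hB
  have hres := exists_valuation_sub_lt_one_of_finiteType (k := k) O hO.2 hB
  have hkO : ∀ c : k, O.valuation (algebraMap k F c) ≤ 1 := fun c =>
    (O.valuation_le_one_iff _).mpr (hO.1 c)
  refine ⟨hdvr, fun a ha => ?_, fun D => ?_⟩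
  · obtain ⟨b, s, hs, h⟩ := hfrac a ha
    obtain ⟨c, hc⟩ := hres b
    obtain ⟨d, hd⟩ := hres s
    have hd0 : d ≠ 0 := by
      rintro rfl
      rw [map_zero, sub_zero, hs] at hd
      exact lt_irrefl _ hd
    have hd1 : algebraMap k F d ≠ 0 := by simpa using hd0
    have hvd : O.valuation (algebraMap k F d) = 1 := by
      refine le_antisymm (hkO d) ?_
      have := hkO d⁻¹
      rw [map_inv₀, map_inv₀] at this
      exact (inv_le_one₀ (by simpa [zero_lt_iff] using hd0)).mp this
    -- The residue of `a = b / s` is the quotient of the residues `c` of `b` and `d` of `s`; `d ≠ 0`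
    -- because `s` is a unit of `O`.
    refine ⟨c / d, ?_⟩
    have key : a - algebraMap k F (c / d) = ((algebraMap B F b - algebraMap k F c)
        - a * (algebraMap B F s - algebraMap k F d)) / algebraMap k F d := by
      rw [map_div₀, mul_sub, h]; field_simp; ring
    rw [key, map_div₀, hvd, div_one]
    refine O.valuation.map_sub_lt hc ?_
    rw [map_mul]
    exact lt_of_le_of_lt (mul_le_of_le_one_left' ((O.valuation_le_one_iff _).mpr ha)) hd
  · obtain ⟨s, hs0, hs⟩ := exists_denominator_derivation (B := B) D
    refine ⟨algebraMap B F s, by simpa using hs0, fun a ha => ?_⟩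
    obtain ⟨b, u, hu, h⟩ := hfrac a ha
    have hu0 : algebraMap B F u ≠ 0 := by
      rintro h0
      rw [h0, map_zero] at hu
      exact zero_ne_one hu
    have hD := congrArg D h
    rw [D.leibniz, smul_eq_mul, smul_eq_mul] at hD
    obtain ⟨b', hb'⟩ := hs b
    obtain ⟨u', hu'⟩ := hs u
    -- Quotient rule for `a = b / u`: as `u` is a unit of `O`, the denominator found for `B` serves
    -- all of `O`.
    have key : algebraMap B F s * D a = (algebraMap B F b' - a * algebraMap B F u') /
        algebraMap B F u := by
      rw [← hb', ← hu', ← hD]; field_simp; ring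
    rw [← O.valuation_le_one_iff, key, map_div₀, hu, div_one, O.valuation_le_one_iff]
    exact sub_mem (hB b') (mul_mem ha (hB u'))

end Place

/-! ### Uniformizers, pole orders and derivations -/

section Uniformizer

variable {k F : Type*} [Field k] [Field F] [Algebra k F] {O : ValuationSubring F} {π : F}

/-- `π` generates the maximal ideal of the discrete valuation ring `O` of `F`. -/
structure IsUniformizer (O : ValuationSubring F) (π : F) : Prop where
  ne_zero : π ≠ 0
  lt_one : O.valuation π < 1
  exists_zpow : ∀ w : F, w ≠ 0 → ∃ n : ℤ, O.valuation w = O.valuation π ^ n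

theorem exists_isUniformizer (O : ValuationSubring F) [IsDiscreteValuationRing O] :
    ∃ π, IsUniformizer O π := by
  obtain ⟨π, hπ⟩ := IsDiscreteValuationRing.exists_irreducible O
  have hO : ∀ a ∈ O, a ≠ 0 → ∃ n : ℕ, O.valuation a = O.valuation (π : F) ^ n := by
    intro a ha ha0
    obtain ⟨n, u, hu⟩ := IsDiscreteValuationRing.associated_pow_irreducible
      (x := (⟨a, ha⟩ : O)) (fun h => ha0 (congrArg Subtype.val h)) hπ
    refine ⟨n, ?_⟩
    have := congrArg (fun b : O => O.valuation (b : F)) hu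
    simpa using this
  refine ⟨π, by simpa using hπ.ne_zero, ?_, fun w hw => ?_⟩
  · exact (O.valuation_lt_one_iff π).mp ((IsLocalRing.mem_maximalIdeal π).mpr hπ.not_isUnit)
  · rcases O.mem_or_inv_mem w with h | h
    · obtain ⟨n, hn⟩ := hO w h hw
      exact ⟨n, by simpa using hn⟩
    · obtain ⟨n, hn⟩ := hO _ h (inv_ne_zero hw)
      exact ⟨-n, by rw [zpow_neg, zpow_natCast, ← hn, map_inv₀, inv_inv]⟩

namespace IsUniformizer

theorem pos (h : IsUniformizer O π) : 0 < O.valuation π := by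
  simpa [zero_lt_iff] using h.ne_zero

theorem zpow_le_iff (h : IsUniformizer O π) {m n : ℤ} :
    O.valuation π ^ m ≤ O.valuation π ^ n ↔ n ≤ m :=
  zpow_le_zpow_iff_right_of_lt_one₀ h.pos h.lt_one

theorem zpow_lt_iff (h : IsUniformizer O π) {m n : ℤ} :
    O.valuation π ^ m < O.valuation π ^ n ↔ n < m :=
  zpow_lt_zpow_iff_right_of_lt_one₀ h.pos h.lt_one

theorem zpow_inj (h : IsUniformizer O π) {m n : ℤ} :
    O.valuation π ^ m = O.valuation π ^ n ↔ m = n := by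
  rw [le_antisymm_iff, h.zpow_le_iff, h.zpow_le_iff, le_antisymm_iff, and_comm]

theorem valuation_le (h : IsUniformizer O π) {a : F} (ha : O.valuation a < 1) :
    O.valuation a ≤ O.valuation π := by
  rcases eq_or_ne a 0 with rfl | ha0
  · simp
  · obtain ⟨n, hn⟩ := h.exists_zpow a ha0
    rw [hn, ← zpow_zero (O.valuation π), h.zpow_lt_iff] at ha
    rw [hn]
    conv_rhs => rw [← zpow_one (O.valuation π)]
    rw [h.zpow_le_iff]
    omega

theorem valuation_le_zpow_of_lt (h : IsUniformizer O π) {a : F} {n : ℤ}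
    (ha : O.valuation a < O.valuation π ^ n) : O.valuation a ≤ O.valuation π ^ (n + 1) := by
  rcases eq_or_ne a 0 with rfl | ha0
  · simp
  · obtain ⟨m, hm⟩ := h.exists_zpow a ha0
    rw [hm, h.zpow_lt_iff] at ha
    rw [hm, h.zpow_le_iff]
    omega

theorem exists_pow_lt (h : IsUniformizer O π) {a : F} (ha : a ≠ 0) :
    ∃ n : ℕ, O.valuation π ^ n < O.valuation a := by
  obtain ⟨n, hn⟩ := h.exists_zpow a ha
  refine ⟨n.toNat + 1, ?_⟩
  rw [hn, ← zpow_natCast, h.zpow_lt_iff]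
  omega

theorem mem_maximalIdeal_pow_iff (h : IsUniformizer O π) (n : ℕ) (a : O) :
    a ∈ IsLocalRing.maximalIdeal O ^ n ↔ O.valuation (a : F) ≤ O.valuation π ^ n := by
  have hπO : π ∈ O := (O.valuation_le_one_iff π).mp h.lt_one.le
  have hspan : IsLocalRing.maximalIdeal O = Ideal.span {⟨π, hπO⟩} := by
    ext b
    rw [O.valuation_lt_one_iff, Ideal.mem_span_singleton]
    constructor
    · intro hb
      obtain ⟨c, hc⟩ := (O.valuation_le_iff _ _).mp (h.valuation_le hb)
      exact ⟨c, Subtype.ext (by rw [← hc, mul_comm]; rfl)⟩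
    · rintro ⟨c, rfl⟩
      rw [show ((⟨π, hπO⟩ * c : O) : F) = π * c from rfl, map_mul]
      exact lt_of_le_of_lt (mul_le_of_le_one_right' (O.valuation_le_one c)) h.lt_one
  rw [hspan, Ideal.span_singleton_pow, Ideal.mem_span_singleton, ← map_pow, O.valuation_le_iff]
  constructor
  · rintro ⟨c, rfl⟩
    exact ⟨c, mul_comm _ _⟩
  · rintro ⟨c, hc⟩
    exact ⟨c, Subtype.ext (by rw [← hc, mul_comm]; rfl)⟩

/-- The set defining `poleOrder` is nonempty because every nonzero valuation is a power of that of
`π`; hence its `sInf` is attained and is not the default value. Only an upper bound is claimed: the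
pole order is `0` for every regular function, whatever its zeros. -/
theorem poleOrder_spec (h : IsUniformizer O π) (a : F) :
    O.valuation a ≤ O.valuation π ^ (-(poleOrder O a : ℤ)) := by
  have hiff : ∀ n : ℕ, (∀ t ∈ IsLocalRing.maximalIdeal O ^ n, (t : F) * a ∈ O) ↔
      O.valuation π ^ n * O.valuation a ≤ 1 := by
    intro n
    have hπO : π ∈ O := (O.valuation_le_one_iff π).mp h.lt_one.le
    constructor
    · intro H
      have := H (⟨π, hπO⟩ ^ n) ((h.mem_maximalIdeal_pow_iff _ _).mpr (by simp))
      rw [← O.valuation_le_one_iff, map_mul] at this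
      simpa using this
    · intro H t ht
      rw [← O.valuation_le_one_iff, map_mul]
      exact le_trans (mul_le_mul_left ((h.mem_maximalIdeal_pow_iff _ _).mp ht) _) H
  have hne : {n | ∀ t ∈ IsLocalRing.maximalIdeal O ^ n, (t : F) * a ∈ O}.Nonempty := by
    rcases eq_or_ne a 0 with rfl | ha
    · exact ⟨0, (hiff 0).mpr (by simp)⟩
    · obtain ⟨n, hn⟩ := h.exists_pow_lt (inv_ne_zero ha)
      refine ⟨n, (hiff n).mpr ?_⟩
      rw [map_inv₀] at hn
      have hva : O.valuation a ≠ 0 := by simpa using ha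
      have := mul_le_mul_left hn.le (O.valuation a)
      rwa [inv_mul_cancel₀ hva] at this
  have := (hiff _).mp (Nat.sInf_mem hne)
  rw [zpow_neg, zpow_natCast]
  refine (le_inv_mul_iff₀ (pow_pos h.pos _)).mpr ?_ |>.trans_eq (mul_one _)
  exact this

/-- A derivation `D` with bounded poles maps `O` into `O · Dπ`. -/
theorem valuation_derivation_le (h : IsUniformizer O π)
    (hk : ∀ c : k, algebraMap k F c ∈ O)
    (hres : ∀ a ∈ O, ∃ c : k, O.valuation (a - algebraMap k F c) < 1)
    (D : Derivation k F F) (hD : ∃ s : F, s ≠ 0 ∧ ∀ a ∈ O, s * D a ∈ O) {a : F} (ha : a ∈ O) :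
    O.valuation (D a) ≤ O.valuation (D π) := by
  have hπO : π ∈ O := (O.valuation_le_one_iff π).mp h.lt_one.le
  have hpoly : ∀ q : Polynomial k, Polynomial.aeval π q ∈ O := fun q => by
    induction q using Polynomial.induction_on' with
    | add p q hp hq => rw [map_add]; exact add_mem hp hq
    | monomial n c =>
      rw [Polynomial.aeval_monomial]
      exact mul_mem (hk c) (pow_mem hπO n)
  -- Truncated expansion of `a` in powers of `π`, with coefficients in the residue field `k`.
  have hexp : ∀ m : ℕ, ∃ q : Polynomial k, ∃ b ∈ O, a = Polynomial.aeval π q + π ^ m * b := by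
    intro m
    induction m with
    | zero => exact ⟨0, a, ha, by simp⟩
    | succ m ih =>
      obtain ⟨q, b, hb, rfl⟩ := ih
      obtain ⟨c, hc⟩ := hres b hb
      obtain ⟨b', hb'⟩ := (O.valuation_le_iff _ _).mp (h.valuation_le hc)
      refine ⟨q + Polynomial.monomial m c, b', b'.2, ?_⟩
      rw [map_add, Polynomial.aeval_monomial, pow_succ]
      linear_combination -π ^ m * hb'
  by_contra! hlt
  obtain ⟨s, hs0, hs⟩ := hD
  have hDa : D a ≠ 0 := by
    intro h0
    rw [h0, map_zero] at hlt
    exact not_lt_zero hlt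
  -- Since `s * D b` is regular, this `m` makes the remainder `π ^ m * D b` strictly smaller than `D
  -- a`. The rest of `D a` is a regular multiple of `D π`, also assumed smaller, and the ultrametric
  -- inequality is contradicted.
  obtain ⟨m, hm⟩ := h.exists_pow_lt (mul_ne_zero hs0 hDa)
  obtain ⟨q, b, hb, hab⟩ := hexp m
  have hda : D a = (Polynomial.aeval π (Polynomial.derivative q) + m * π ^ (m - 1) * b) * D π +
      π ^ m * D b := by
    rw [hab, map_add, D.map_aeval, D.leibniz, D.leibniz_pow]
    simp only [smul_eq_mul, nsmul_eq_mul]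
    ring
  have h1 : O.valuation ((Polynomial.aeval π (Polynomial.derivative q) + m * π ^ (m - 1) * b) * D π)
      < O.valuation (D a) := by
    rw [map_mul]
    refine lt_of_le_of_lt (mul_le_of_le_one_left' ((O.valuation_le_one_iff _).mpr ?_)) hlt
    exact add_mem (hpoly _) (mul_mem (mul_mem (natCast_mem O m) (pow_mem hπO _)) hb)
  have h2 : O.valuation (π ^ m * D b) < O.valuation (D a) := by
    have hs' : 0 < O.valuation s := by simpa [zero_lt_iff] using hs0
    rw [← mul_lt_mul_iff_right₀ hs', ← map_mul, ← map_mul]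
    refine lt_of_le_of_lt ?_ hm
    rw [mul_left_comm, map_mul, map_pow]
    exact mul_le_of_le_one_right' ((O.valuation_le_one_iff _).mpr (hs b hb))
  exact lt_irrefl _ (lt_of_eq_of_lt (congrArg _ hda) (O.valuation.map_add_lt h1 h2))

end IsUniformizer

end Uniformizer

/-! ### The rational subfield at a zero of its generator -/

section RationalSubfield

variable {k F : Type*} [Field k] [Field F] [Algebra k F] {O : ValuationSubring F} {y : F}

theorem valuation_algebraMap (hk : ∀ c : k, algebraMap k F c ∈ O) {c : k} (hc : c ≠ 0) :
    O.valuation (algebraMap k F c) = 1 := by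
  have hkO : ∀ c : k, O.valuation (algebraMap k F c) ≤ 1 := fun c =>
    (O.valuation_le_one_iff _).mpr (hk c)
  refine le_antisymm (hkO c) ?_
  have := hkO c⁻¹
  rw [map_inv₀, map_inv₀] at this
  exact (inv_le_one₀ (by simpa [zero_lt_iff] using hc)).mp this

theorem aeval_mem (hk : ∀ c : k, algebraMap k F c ∈ O) (hy : y ∈ O) (q : Polynomial k) :
    Polynomial.aeval y q ∈ O := by
  induction q using Polynomial.induction_on' with
  | add p q hp hq => rw [map_add]; exact add_mem hp hq
  | monomial n c =>
    rw [Polynomial.aeval_monomial]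
    exact mul_mem (hk c) (pow_mem hy n)

theorem valuation_aeval_of_coeff_zero_ne_zero (hk : ∀ c : k, algebraMap k F c ∈ O)
    (hy : O.valuation y < 1) {q : Polynomial k} (hq : q.coeff 0 ≠ 0) :
    O.valuation (Polynomial.aeval y q) = 1 := by
  rw [← Polynomial.divX_mul_X_add q, map_add, map_mul, Polynomial.aeval_X, Polynomial.aeval_C,
    ← valuation_algebraMap hk hq]
  refine O.valuation.map_add_eq_of_lt_right ?_
  rw [valuation_algebraMap hk hq, map_mul]
  exact lt_of_le_of_lt (mul_le_of_le_one_left' ((O.valuation_le_one_iff _).mpr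
    (aeval_mem hk ((O.valuation_le_one_iff _).mp hy.le) _))) hy

/-- Splits off the zero or pole at `y = 0`. Polynomials with nonzero constant term are units
wherever `y` vanishes, so only the power of `y` affects the valuation. -/
theorem exists_eq_zpow_mul (hy0 : y ≠ 0) {a : F} (ha : a ∈ k⟮y⟯) (ha0 : a ≠ 0) :
    ∃ n : ℤ, ∃ p q : Polynomial k, p.coeff 0 ≠ 0 ∧ q.coeff 0 ≠ 0 ∧
      a = y ^ n * (Polynomial.aeval y p / Polynomial.aeval y q) := by
  have key : ∀ p : Polynomial k, p ≠ 0 → ∃ n : ℕ, ∃ p' : Polynomial k, p'.coeff 0 ≠ 0 ∧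
      Polynomial.aeval y p = y ^ n * Polynomial.aeval y p' := by
    intro p hp
    obtain ⟨p', h1, h2⟩ := Polynomial.exists_eq_pow_rootMultiplicity_mul_and_not_dvd p hp 0
    rw [map_zero, sub_zero] at h1 h2
    refine ⟨p.rootMultiplicity 0, p', fun h => h2 (Polynomial.X_dvd_iff.mpr h), ?_⟩
    conv_lhs => rw [h1]
    simp
  obtain ⟨p, q, rfl⟩ := (IntermediateField.mem_adjoin_simple_iff k a).mp ha
  have hp : p ≠ 0 := by rintro rfl; simp at ha0
  have hq : q ≠ 0 := by rintro rfl; simp at ha0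
  obtain ⟨m, p', hp', hp⟩ := key p hp
  obtain ⟨n, q', hq', hq⟩ := key q hq
  refine ⟨m - n, p', q', hp', hq', ?_⟩
  rw [hp, hq, zpow_sub₀ hy0, zpow_natCast, zpow_natCast, mul_div_mul_comm]

theorem exists_valuation_eq_zpow (hk : ∀ c : k, algebraMap k F c ∈ O) (hy : O.valuation y < 1)
    (hy0 : y ≠ 0) {a : F} (ha : a ∈ k⟮y⟯) (ha0 : a ≠ 0) :
    ∃ n : ℤ, O.valuation a = O.valuation y ^ n := by
  obtain ⟨n, p, q, hp, hq, rfl⟩ := exists_eq_zpow_mul hy0 ha ha0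
  refine ⟨n, ?_⟩
  rw [map_mul, map_div₀, valuation_aeval_of_coeff_zero_ne_zero hk hy hp,
    valuation_aeval_of_coeff_zero_ne_zero hk hy hq, div_one, mul_one, map_zpow₀]

theorem valuation_le_of_mem_adjoin (hk : ∀ c : k, algebraMap k F c ∈ O) (hy : O.valuation y < 1)
    (hy0 : y ≠ 0) {a : F} (ha : a ∈ k⟮y⟯) (ha1 : O.valuation a < 1) :
    O.valuation a ≤ O.valuation y := by
  rcases eq_or_ne a 0 with rfl | ha0
  · simp
  obtain ⟨n, hn⟩ := exists_valuation_eq_zpow hk hy hy0 ha ha0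
  have hpos : 0 < O.valuation y := by simpa [zero_lt_iff] using hy0
  rw [hn, ← zpow_zero (O.valuation y), zpow_lt_zpow_iff_right_of_lt_one₀ hpos hy] at ha1
  rw [hn]
  conv_rhs => rw [← zpow_one (O.valuation y)]
  rw [zpow_le_zpow_iff_right_of_lt_one₀ hpos hy]
  omega

/-- Over a rational function field, derivatives of regular functions are regular. -/
theorem valuation_derivation_le_of_mem_adjoin (hk : ∀ c : k, algebraMap k F c ∈ O)
    (hy : O.valuation y < 1) (hy0 : y ≠ 0) (D : Derivation k F F) {a : F} (ha : a ∈ k⟮y⟯)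
    (ha1 : O.valuation a ≤ 1) : O.valuation (D a) ≤ O.valuation (D y) := by
  rcases eq_or_ne a 0 with rfl | ha0
  · simp
  obtain ⟨n, p, q, hp, hq, rfl⟩ := exists_eq_zpow_mul hy0 ha ha0
  have hpos : 0 < O.valuation y := by simpa [zero_lt_iff] using hy0
  have hvq := valuation_aeval_of_coeff_zero_ne_zero hk hy hq
  have hyO := (O.valuation_le_one_iff _).mp hy.le
  rw [map_mul, map_div₀, valuation_aeval_of_coeff_zero_ne_zero hk hy hp, hvq, div_one, mul_one,
    map_zpow₀, ← zpow_zero (O.valuation y), zpow_le_zpow_iff_right_of_lt_one₀ hpos hy] at ha1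
  lift n to ℕ using ha1
  have hq0 : Polynomial.aeval y q ≠ 0 := by
    intro h; rw [h, map_zero] at hvq; exact zero_ne_one hvq
  -- Regularity has forced `n ≥ 0`, so `a` is a quotient of polynomials in `y` whose denominator is
  -- a unit; the quotient rule writes `D a` as a regular multiple of `D y`.
  have hmul : y ^ (n : ℤ) * (Polynomial.aeval y p / Polynomial.aeval y q) * Polynomial.aeval y q =
      Polynomial.aeval y (Polynomial.X ^ n * p) := by
    rw [map_mul, map_pow, Polynomial.aeval_X, zpow_natCast]
    field_simp
  set a := y ^ (n : ℤ) * (Polynomial.aeval y p / Polynomial.aeval y q) with hadef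
  have haO : a ∈ O := by
    rw [hadef, zpow_natCast]
    refine mul_mem (pow_mem hyO n) ((O.valuation_le_one_iff _).mp ?_)
    rw [map_div₀, hvq, div_one]
    exact (O.valuation_le_one_iff _).mpr (aeval_mem hk hyO _)
  have hD := congrArg D hmul
  rw [D.leibniz, D.map_aeval, D.map_aeval, smul_eq_mul, smul_eq_mul, smul_eq_mul, smul_eq_mul] at hD
  have hDa : D a = (Polynomial.aeval y (Polynomial.derivative (Polynomial.X ^ n * p)) -
      a * Polynomial.aeval y (Polynomial.derivative q)) / Polynomial.aeval y q * D y := by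
    field_simp
    linear_combination hD
  rw [hDa, map_mul, map_div₀, hvq, div_one]
  exact mul_le_of_le_one_left' ((O.valuation_le_one_iff _).mpr
    (sub_mem (aeval_mem hk hyO _) (mul_mem haO (aeval_mem hk hyO _))))

/-- No element of `k(y)` in the maximal ideal has larger valuation than `y`, so `y` alone generates
the extended ideal that is compared with the `e`-th power. -/
theorem HasRamificationIndex.valuation_eq_pow {E : IntermediateField k F} (hE : E = k⟮y⟯)
    (hk : ∀ c : k, algebraMap k F c ∈ O) (hy : O.valuation y < 1) (hy0 : y ≠ 0) {e : ℕ}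
    (h : HasRamificationIndex E O e) {π : F} (hπ : IsUniformizer O π) :
    O.valuation y = O.valuation π ^ e := by
  have hπO : π ∈ O := (O.valuation_le_one_iff π).mp hπ.lt_one.le
  have hyO := (O.valuation_le_one_iff _).mp hy.le
  refine le_antisymm ?_ ?_
  · refine (hπ.mem_maximalIdeal_pow_iff e ⟨y, hyO⟩).mp ?_
    rw [← h]
    refine Ideal.subset_span ⟨?_, (O.valuation_lt_one_iff _).mpr hy⟩
    rw [hE]
    exact IntermediateField.mem_adjoin_simple_self k y
  · have hmem : (⟨π, hπO⟩ ^ e : O) ∈ IsLocalRing.maximalIdeal O ^ e :=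
      (hπ.mem_maximalIdeal_pow_iff _ _).mpr (by simp)
    rw [← h] at hmem
    have : ∀ b : O, b ∈ Ideal.span {a : O | (a : F) ∈ E ∧ a ∈ IsLocalRing.maximalIdeal O} →
        O.valuation (b : F) ≤ O.valuation y := by
      intro b hb
      induction hb using Submodule.span_induction with
      | mem a ha =>
        exact valuation_le_of_mem_adjoin hk hy hy0 (hE ▸ ha.1) ((O.valuation_lt_one_iff a).mp ha.2)
      | zero => simp
      | add a b _ _ ha hb => exact le_trans (O.valuation.map_add _ _) (max_le ha hb)
      | smul c a _ ha =>
        rw [smul_eq_mul, show ((c * a : O) : F) = c * a from rfl, map_mul]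
        exact le_trans (mul_le_of_le_one_left' (O.valuation_le_one c)) ha
    simpa using this _ hmem

end RationalSubfield

-- Chain rule with a correction for nonconstant coefficients. For the minimal polynomial of `w` it
-- expresses `f'(w) * D w` through the derivatives of the coefficients.
open Polynomial in
theorem derivation_aeval_intermediateField {k F : Type*} [Field k] [Field F] [Algebra k F]
    {E : IntermediateField k F} (D : Derivation k F F) (g : E[X]) (w : F) :
    D (aeval w g) = aeval w (derivative g) * D w + g.sum fun i a => D (a : F) * w ^ i := by
  induction g using Polynomial.induction_on' with
  | add p q hp hq =>
    rw [map_add, map_add, hp, hq, derivative_add, map_add, Polynomial.sum_add_index]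
    · ring
    · simp
    · intro i a b
      rw [show ((a + b : E) : F) = a + b from rfl, map_add]; ring
  | monomial n a =>
    rw [Polynomial.sum_monomial_index _ _ (by simp), aeval_monomial, derivative_monomial,
      aeval_monomial, D.leibniz, D.leibniz_pow]
    simp only [smul_eq_mul, nsmul_eq_mul, map_mul, map_natCast]
    rw [show algebraMap E F a = (a : F) from rfl]
    ring

open Polynomial in
/-- Euler's formula for the trace of `x ^ j / f'(x)`. -/
theorem trace_pow_div_derivative {K L : Type*} [Field K] [Field L] [Algebra K L]
    [FiniteDimensional K L] [Algebra.IsSeparable K L] (pb : PowerBasis K L) (j : Fin pb.dim) :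
    Algebra.trace K L (pb.gen ^ (j : ℕ) / aeval pb.gen (derivative (minpoly K pb.gen))) =
      if (j : ℕ) + 1 = pb.dim then 1 else 0 := by
  have hpos : 0 < pb.dim := pb.dim_pos
  -- The trace-dual of the power basis consists of the coefficients of `f / (X - x)` divided by
  -- `f'(x)`; the leading coefficient `1` gives the dual of the top power.
  have h := (Module.Basis.traceDual_eq_iff (b := pb.basis)).mp
    (funext (Module.Basis.traceDual_powerBasis_eq pb)) ⟨pb.dim - 1, by omega⟩ j
  have hint : IsIntegral K pb.gen := pb.isIntegral_gen
  have hlead : (minpolyDiv K pb.gen).coeff (pb.dim - 1) = 1 := by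
    rw [← pb.natDegree_minpoly, ← natDegree_minpolyDiv]
    exact minpolyDiv_monic hint
  rw [Algebra.traceForm_apply, hlead, pb.coe_basis] at h
  simp only [Fin.ext_iff] at h
  rw [show pb.gen ^ (j : ℕ) / aeval pb.gen (derivative (minpoly K pb.gen)) =
    1 / aeval pb.gen (derivative (minpoly K pb.gen)) * pb.gen ^ (j : ℕ) by ring, h]
  congr 1
  exact propext (by omega)

/-! ### Different and trace at a totally ramified place -/

section TotallyRamified

variable {k F : Type*} [Field k] [Field F] [Algebra k F] {O : ValuationSubring F} {π t : F}
  {E : IntermediateField k F}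

/-- At a totally ramified place, the terms of a combination of the powers of a uniformizer have
different valuations. -/
theorem IsUniformizer.valuation_term_le (hπ : IsUniformizer O π) {n : ℕ}
    (hE : ∀ c ∈ E, c ≠ 0 → ∃ m : ℤ, O.valuation c = O.valuation π ^ (n * m))
    (c : Fin n → E) (i : Fin n) :
    O.valuation (c i * π ^ (i : ℕ)) ≤ O.valuation (∑ j, c j * π ^ (j : ℕ)) := by
  classical
  by_cases hc : ∀ j, c j = 0
  · simp [hc]
  push Not at hc
  have hne : (Finset.univ.filter fun j => c j ≠ 0).Nonempty := by
    obtain ⟨j, hj⟩ := hc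
    exact ⟨j, by simpa using hj⟩
  obtain ⟨j, hj, hmax⟩ := Finset.exists_max_image _
    (fun j : Fin n => O.valuation (c j * π ^ (j : ℕ))) hne
  have hj0 : c j ≠ 0 := by simpa using hj
  have hvj : O.valuation (c j * π ^ (j : ℕ)) ≠ 0 := by
    simpa [hπ.ne_zero] using hj0
  have hval : ∀ l, c l ≠ 0 → ∃ m : ℤ,
      O.valuation (c l * π ^ (l : ℕ)) = O.valuation π ^ (n * m + l) := by
    intro l hl
    obtain ⟨m, hm⟩ := hE _ (c l).2 (by simpa using hl)
    refine ⟨m, ?_⟩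
    rw [map_mul, map_pow, hm, zpow_add₀ hπ.pos.ne', zpow_natCast]
  have hlt : ∀ l, l ≠ j → O.valuation (c l * π ^ (l : ℕ)) < O.valuation (c j * π ^ (j : ℕ)) := by
    intro l hl
    by_cases hl0 : c l = 0
    · rw [hl0]
      simpa [zero_lt_iff] using hvj
    · refine lt_of_le_of_ne (hmax l (by simpa using hl0)) fun heq => hl ?_
      obtain ⟨a, ha⟩ := hval l hl0
      obtain ⟨b, hb⟩ := hval j hj0
      rw [ha, hb, hπ.zpow_inj] at heq
      have h1 := l.2
      have h2 := j.2
      -- The exponent of the `l`-th term is congruent to `l` modulo `n`, so nonzero terms with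
      -- different indices never have equal valuations.
      have h3 : ((n : ℤ) * a + l) % n = ((n : ℤ) * b + j) % n := by rw [heq]
      rw [Int.mul_add_emod_self_left, Int.mul_add_emod_self_left,
        Int.emod_eq_of_lt (by omega) (by omega), Int.emod_eq_of_lt (by omega) (by omega)] at h3
      exact Fin.ext (by omega)
  have hsum : O.valuation (∑ l, c l * π ^ (l : ℕ)) = O.valuation (c j * π ^ (j : ℕ)) := by
    rw [← Finset.add_sum_erase _ _ (Finset.mem_univ j)]
    refine O.valuation.map_add_eq_of_lt_left ?_
    exact O.valuation.map_sum_lt hvj fun l hl => hlt l (Finset.ne_of_mem_erase hl)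
  rw [hsum]
  by_cases hij : i = j
  · rw [hij]
  · exact (hlt i hij).le

/-- The powers of a uniformizer at a totally ramified place form a basis. -/
theorem IsUniformizer.exists_powerBasis [FiniteDimensional E F] (hπ : IsUniformizer O π)
    (hE : ∀ c ∈ E, c ≠ 0 →
      ∃ m : ℤ, O.valuation c = O.valuation π ^ ((Module.finrank E F : ℤ) * m)) :
    ∃ pb : PowerBasis E F, pb.gen = π ∧ pb.dim = Module.finrank E F := by
  have hli : LinearIndependent E fun i : Fin (Module.finrank E F) => π ^ (i : ℕ) := by
    rw [Fintype.linearIndependent_iff]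
    intro c hc i
    have := hπ.valuation_term_le hE c i
    simp only [Algebra.smul_def] at hc
    rw [show ∑ j, (c j : F) * π ^ (j : ℕ) = 0 from hc, map_zero] at this
    have h0 := O.valuation.zero_iff.mp (le_zero_iff.mp this)
    simpa [hπ.ne_zero] using h0
  have hpos : 0 < Module.finrank E F := Module.finrank_pos
  have : Nonempty (Fin (Module.finrank E F)) := ⟨⟨0, hpos⟩⟩
  refine ⟨⟨π, Module.finrank E F, basisOfLinearIndependentOfCardEqFinrank hli (by simp), ?_⟩,
    rfl, rfl⟩
  intro i
  simp

theorem IsUniformizer.exists_eq_sum [FiniteDimensional E F] (hπ : IsUniformizer O π)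
    (hE : ∀ c ∈ E, c ≠ 0 →
      ∃ m : ℤ, O.valuation c = O.valuation π ^ ((Module.finrank E F : ℤ) * m)) (w : F) :
    ∃ c : Fin (Module.finrank E F) → E, w = ∑ i, c i * π ^ (i : ℕ) := by
  obtain ⟨pb, hgen, hdim⟩ := hπ.exists_powerBasis hE
  refine ⟨fun i => pb.basis.repr w (Fin.cast hdim.symm i), ?_⟩
  conv_lhs => rw [← pb.basis.sum_repr w]
  refine Fintype.sum_equiv (finCongr hdim) _ _ fun i => ?_
  rw [pb.basis_eq_pow, hgen, Algebra.smul_def]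
  rfl

theorem exists_valuation_eq_zpow_finrank [FiniteDimensional E F]
    (hk : ∀ c : k, algebraMap k F c ∈ O) (hEt : E = k⟮t⟯)
    (ht : O.valuation t = O.valuation π ^ Module.finrank E F) (hπ : IsUniformizer O π)
    (c : F) (hc : c ∈ E) (hc0 : c ≠ 0) :
    ∃ m : ℤ, O.valuation c = O.valuation π ^ ((Module.finrank E F : ℤ) * m) := by
  have ht0 : t ≠ 0 := by
    rintro rfl
    rw [map_zero] at ht
    exact (pow_ne_zero _ hπ.pos.ne') ht.symm
  have ht1 : O.valuation t < 1 := by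
    rw [ht]; exact pow_lt_one₀ zero_le hπ.lt_one Module.finrank_pos.ne'
  obtain ⟨m, hm⟩ := exists_valuation_eq_zpow hk ht1 ht0 (hEt ▸ hc) hc0
  exact ⟨m, by rw [hm, ht, zpow_mul, zpow_natCast]⟩

open Polynomial in
/-- The different exponent at a totally ramified place computes the zeros of `dt / dπ`. -/
theorem IsUniformizer.valuation_derivative_minpoly_mul [FiniteDimensional E F]
    (hπ : IsUniformizer O π) (hk : ∀ c : k, algebraMap k F c ∈ O)
    (hEt : E = k⟮t⟯) (ht : O.valuation t = O.valuation π ^ Module.finrank E F)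
    (D : Derivation k F F) (hDt : D t ≠ 0) :
    O.valuation (aeval π (derivative (minpoly E π)) * D π) = O.valuation (D t) := by
  set n := Module.finrank E F with hn
  have hpos : 0 < n := Module.finrank_pos
  have ht0 : t ≠ 0 := by rintro rfl; simp at hDt
  have ht1 : O.valuation t < 1 := by
    rw [ht]; exact pow_lt_one₀ zero_le hπ.lt_one hpos.ne'
  have htE : t ∈ E := hEt ▸ IntermediateField.mem_adjoin_simple_self k t
  have hE := exists_valuation_eq_zpow_finrank hk hEt ht hπ
  have hDE : ∀ u ∈ E, O.valuation u ≤ 1 → O.valuation (D u) ≤ O.valuation (D t) := fun u hu hu1 =>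
    valuation_derivation_le_of_mem_adjoin hk ht1 ht0 D (hEt ▸ hu) hu1
  obtain ⟨pb, hgen, hdim⟩ := hπ.exists_powerBasis hE
  have hdeg : (minpoly E π).natDegree = n := by rw [← hgen, pb.natDegree_minpoly, hdim]
  have hlead : (minpoly E π).coeff n = 1 := by
    rw [← hdeg]; exact minpoly.monic (hgen ▸ pb.isIntegral_gen)
  set a : Fin n → E := fun i => (minpoly E π).coeff i with ha
  have hsum : ∑ i, (a i : F) * π ^ (i : ℕ) = -π ^ n := by
    have := minpoly.aeval E π
    rw [aeval_eq_sum_range, hdeg, Finset.sum_range_succ, hlead, one_smul,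
      Finset.sum_range] at this
    rw [← add_eq_zero_iff_eq_neg, ← this]
    simp [ha, Algebra.smul_def]
  have hvsum : O.valuation (∑ i, (a i : F) * π ^ (i : ℕ)) = O.valuation t := by
    rw [hsum, Valuation.map_neg, map_pow, ht]
  -- The minimal polynomial of `π` is Eisenstein at `t`. The exponent `n m + i` of the `i`-th term
  -- is at least `n`, and `i < n`, whence `m ≥ 1`.
  have hat : ∀ i, O.valuation (a i : F) ≤ O.valuation t := by
    intro i
    by_cases h0 : a i = 0
    · simp [h0]
    obtain ⟨m, hm⟩ := hE _ (a i).2 (by simpa using h0)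
    have h := hπ.valuation_term_le hE a i
    rw [hvsum, map_mul, map_pow, hm, ht, ← zpow_natCast, ← zpow_natCast, ← zpow_add₀ hπ.pos.ne',
      hπ.zpow_le_iff] at h
    have hi : ((i : ℕ) : ℤ) < n := by exact_mod_cast i.2
    have hm1 : 1 ≤ m := by
      by_contra! hm1
      nlinarith
    rw [hm, ht, ← zpow_natCast, hπ.zpow_le_iff]
    nlinarith
  have hvt : 0 < O.valuation t := by simpa [zero_lt_iff] using ht0
  have hvDt : 0 < O.valuation (D t) := by simpa [zero_lt_iff] using hDt
  have hu : ∀ i, O.valuation ((a i : F) / t) ≤ 1 := fun i => by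
    rw [map_div₀]; exact div_le_one_of_le₀ (hat i) zero_le
  -- As `a i / t` is regular and lies in `k(t)`, its derivative is bounded by `D t`; the factor `t`
  -- then makes the first summand strictly smaller than `D t`.
  have hDa : ∀ i, D (a i : F) = t * D ((a i : F) / t) + (a i : F) / t * D t := by
    intro i
    conv_lhs => rw [← mul_div_cancel₀ (a i : F) ht0]
    rw [D.leibniz, smul_eq_mul, smul_eq_mul]
  have htD : ∀ i, O.valuation (t * D ((a i : F) / t)) < O.valuation (D t) := by
    intro i
    rw [map_mul]
    refine lt_of_le_of_lt (mul_le_mul_right (hDE _ (div_mem (a i).2 htE) (hu i)) _) ?_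
    exact mul_lt_of_lt_one_left hvDt ht1
  have hDale : ∀ i, O.valuation (D (a i : F)) ≤ O.valuation (D t) := by
    intro i
    rw [hDa]
    refine O.valuation.map_add_le (htD i).le ?_
    rw [map_mul]
    exact mul_le_of_le_one_left' (hu i)
  have hpowlt : ∀ i : Fin n, i ≠ ⟨0, hpos⟩ → O.valuation (π ^ (i : ℕ)) < 1 := by
    intro i hi
    rw [map_pow]
    exact pow_lt_one₀ zero_le hπ.lt_one fun h => hi (Fin.ext h)
  -- Otherwise every term of the sum equal to `-π ^ n` would be strictly smaller than `t`.
  have hu0 : O.valuation ((a ⟨0, hpos⟩ : F) / t) = 1 := by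
    refine le_antisymm (hu _) (not_lt.mp fun hlt => ?_)
    rw [map_div₀, div_lt_one₀ hvt] at hlt
    refine (O.valuation.map_sum_lt hvt.ne' fun i _ => ?_).ne hvsum
    by_cases hi : i = ⟨0, hpos⟩
    · rw [hi]; simpa using hlt
    · rw [map_mul]
      exact lt_of_le_of_lt (mul_le_mul_left (hat i) _) (mul_lt_of_lt_one_right hvt (hpowlt i hi))
  have hDa0 : O.valuation (D (a ⟨0, hpos⟩ : F)) = O.valuation (D t) := by
    have hv : O.valuation ((a ⟨0, hpos⟩ : F) / t * D t) = O.valuation (D t) := by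
      rw [map_mul, hu0, one_mul]
    rw [hDa, O.valuation.map_add_eq_of_lt_right (by rw [hv]; exact htD _), hv]
  -- Differentiating the minimal equation of `π` gives `f'(π) * D π = -∑ D (a i) * π ^ i`, and the
  -- term `i = 0` dominates.
  have hD0 := derivation_aeval_intermediateField D (minpoly E π) π
  rw [minpoly.aeval, map_zero, Polynomial.sum_over_range _ (by simp), hdeg,
    Finset.sum_range_succ, hlead, Finset.sum_range, show ((1 : E) : F) = 1 from rfl,
    D.map_one_eq_zero, zero_mul, add_zero] at hD0
  rw [eq_neg_of_add_eq_zero_left hD0.symm, Valuation.map_neg,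
    ← Finset.add_sum_erase _ _ (Finset.mem_univ (⟨0, hpos⟩ : Fin n))]
  have hfirst : O.valuation (D (a ⟨0, hpos⟩ : F) * π ^ ((⟨0, hpos⟩ : Fin n) : ℕ)) =
      O.valuation (D t) := by simpa using hDa0
  rw [← hfirst]
  refine O.valuation.map_add_eq_of_lt_left ?_
  rw [hfirst]
  refine O.valuation.map_sum_lt hvDt.ne' fun i hi => ?_
  rw [map_mul]
  exact lt_of_le_of_lt (mul_le_mul_left (hDale i) _)
    (mul_lt_of_lt_one_right hvDt (hpowlt i (Finset.ne_of_mem_erase hi)))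

-- Expand `h * δ / t` in powers of `π`, where `δ = f'(π)`. By Euler's formula the trace of `h` is
-- `t` times the coefficient of `π ^ (n - 1)`. The hypothesis says that the whole expansion has the
-- valuation of `π ^ (n - 1)`, which forces that coefficient to be a unit.
open Polynomial in
theorem IsUniformizer.valuation_trace [FiniteDimensional E F] [Algebra.IsSeparable E F]
    (hπ : IsUniformizer O π) (hE : ∀ c ∈ E, c ≠ 0 →
      ∃ m : ℤ, O.valuation c = O.valuation π ^ ((Module.finrank E F : ℤ) * m))
    (htE : t ∈ E) (ht0 : t ≠ 0) {h : F}
    (hh : O.valuation (h * aeval π (derivative (minpoly E π))) =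
      O.valuation (t * π ^ (Module.finrank E F - 1))) :
    O.valuation (Algebra.trace E F h : F) = O.valuation t := by
  set n := Module.finrank E F with hn
  have hpos : 0 < n := Module.finrank_pos
  obtain ⟨pb, hgen, hdim⟩ := hπ.exists_powerBasis hE
  set δ := aeval π (derivative (minpoly E π)) with hδ
  have hδ0 : δ ≠ 0 :=
    (Algebra.IsSeparable.isSeparable E π).aeval_derivative_ne_zero (minpoly.aeval _ _)
  obtain ⟨c, hc⟩ := hπ.exists_eq_sum hE (h * δ / t)
  have hvt : O.valuation t ≠ 0 := by simpa using ht0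
  have hvw : O.valuation (∑ i, (c i : F) * π ^ (i : ℕ)) = O.valuation π ^ (n - 1) := by
    rw [← hc, map_div₀, hh, map_mul, map_pow, mul_div_cancel_left₀ _ hvt]
  set l : Fin n := ⟨n - 1, by omega⟩ with hl
  have htrace : Algebra.trace E F h = ⟨t, htE⟩ * c l := by
    have hheq : h = ∑ i, (⟨t, htE⟩ * c i) • (π ^ (i : ℕ) / δ) := by
      rw [div_eq_iff ht0, Finset.sum_mul] at hc
      rw [← mul_div_cancel_right₀ h hδ0, hc, Finset.sum_div]
      refine Finset.sum_congr rfl fun i _ => ?_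
      rw [Algebra.smul_def, map_mul]
      change (c i : F) * π ^ (i : ℕ) * t / δ = t * c i * (π ^ (i : ℕ) / δ)
      ring
    have htr : ∀ i : Fin n, Algebra.trace E F (π ^ (i : ℕ) / δ) = if i = l then 1 else 0 := by
      intro i
      have := trace_pow_div_derivative pb (Fin.cast hdim.symm i)
      rw [hgen, Fin.val_cast] at this
      rw [hδ, this]
      congr 1
      rw [Fin.ext_iff]
      exact propext (by simp only [hl]; omega)
    conv_lhs => rw [hheq]
    rw [map_sum]
    simp [htr]
  have hterm : ∀ i, O.valuation ((c i : F) * π ^ (i : ℕ)) ≤ O.valuation π ^ (n - 1) := fun i =>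
    hvw ▸ hπ.valuation_term_le hE c i
  -- For `i < n - 1`, the bound `n m + i ≥ n - 1` forces `m ≥ 1`, so the exponent is at least `n`.
  have hltterm : ∀ i, i ≠ l → O.valuation ((c i : F) * π ^ (i : ℕ)) < O.valuation π ^ (n - 1) := by
    intro i hi
    by_cases h0 : c i = 0
    · simp only [h0, ZeroMemClass.coe_zero, zero_mul, map_zero]
      exact pow_pos hπ.pos _
    obtain ⟨m, hm⟩ := hE _ (c i).2 (by simpa using h0)
    have h := hterm i
    rw [map_mul, map_pow, hm, ← zpow_natCast, ← zpow_natCast, ← zpow_add₀ hπ.pos.ne',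
      hπ.zpow_le_iff] at h
    rw [map_mul, map_pow, hm, ← zpow_natCast, ← zpow_natCast, ← zpow_add₀ hπ.pos.ne',
      hπ.zpow_lt_iff]
    have hi2 : (i : ℕ) < n - 1 := by
      have := i.2
      have : (i : ℕ) ≠ n - 1 := fun h => hi (Fin.ext h)
      omega
    have hm1 : 1 ≤ m := by
      by_contra! hm1
      have : (n : ℤ) * m ≤ 0 := by nlinarith
      omega
    have : (n : ℤ) ≤ n * m := by nlinarith
    omega
  have hcl : O.valuation (c l : F) = 1 := by
    have hpw : O.valuation π ^ (n - 1) ≠ 0 := pow_ne_zero _ hπ.pos.ne'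
    have h1 : O.valuation ((c l : F) * π ^ (l : ℕ)) = O.valuation π ^ (n - 1) := by
      refine le_antisymm (hterm l) (not_lt.mp fun hlt => ?_)
      refine (O.valuation.map_sum_lt hpw fun i _ => ?_).ne hvw
      by_cases hi : i = l
      · rw [hi]; exact hlt
      · exact hltterm i hi
    rw [map_mul, map_pow] at h1
    exact (mul_eq_right₀ hpw).mp h1
  rw [htrace, show ((⟨t, htE⟩ * c l : E) : F) = t * c l from rfl, map_mul, hcl, mul_one]

end TotallyRamified

/-! ### Integrality and valuation rings -/

section Integral

variable {k F : Type*} [Field k] [Field F] [Algebra k F]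

/-- The integral closure of a subring of a field is the intersection of the valuation rings
containing it. -/
theorem isIntegral_adjoin_of_forall_mem {S : Set F} {w : F}
    (h : ∀ O : ValuationSubring F, (∀ c : k, algebraMap k F c ∈ O) → (∀ s ∈ S, s ∈ O) → w ∈ O) :
    IsIntegral (Algebra.adjoin k S) w := by
  have hw : w ∈ (integralClosure (Subring.closure (Set.range (algebraMap k F) ∪ S)) F).toSubring := by
    rw [← iInf_valuationSubring_superset, Subring.mem_iInf]
    rintro ⟨O, hO⟩
    exact h O (fun c => hO (Or.inl ⟨c, rfl⟩)) fun s hs => hO (Or.inr hs)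
  obtain ⟨q, hq, hq0⟩ := (hw : IsIntegral _ w)
  let i : Subring.closure (Set.range (algebraMap k F) ∪ S) →+* Algebra.adjoin k S :=
    Subring.inclusion (T := (Algebra.adjoin k S).toSubring)
      (Algebra.adjoin_eq_ring_closure (R := k) S).ge
  exact ⟨q.map i, hq.map i, by rw [Polynomial.eval₂_map]; exact hq0⟩

theorem mem_of_isIntegral_adjoin {S : Set F} {w : F} (hw : IsIntegral (Algebra.adjoin k S) w)
    {O : ValuationSubring F} (hk : ∀ c : k, algebraMap k F c ∈ O) (hS : ∀ s ∈ S, s ∈ O) :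
    w ∈ O := by
  have hA : ∀ a ∈ Algebra.adjoin k S, a ∈ O := by
    intro a ha
    induction ha using Algebra.adjoin_induction with
    | mem x hx => exact hS x hx
    | algebraMap c => exact hk c
    | add x y _ _ hx hy => exact add_mem hx hy
    | mul x y _ _ hx hy => exact mul_mem hx hy
  let i : Algebra.adjoin k S →+* O :=
    (Algebra.adjoin k S).val.toRingHom.codRestrict O.toSubring fun a => hA a a.2
  obtain ⟨q, hq, hq0⟩ := hw
  have : IsIntegral O w := ⟨q.map i, hq.map i, by rw [Polynomial.eval₂_map]; exact hq0⟩
  obtain ⟨c, hc⟩ := IsIntegrallyClosed.isIntegral_iff.mp this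
  rw [show w = algebraMap O F c from hc.symm]
  exact c.2

/-- A function without poles is constant. -/
theorem isIntegral_of_forall_mem {w : F}
    (h : ∀ O : ValuationSubring F, IsPlace k O → w ∈ O) : IsIntegral k w := by
  have hw : IsIntegral (Algebra.adjoin k (∅ : Set F)) w :=
    isIntegral_adjoin_of_forall_mem fun O hO _ => by
      by_cases htop : O = ⊤
      · rw [htop]; trivial
      · exact h O ⟨hO, htop⟩
  have : Algebra.IsIntegral k (Algebra.adjoin k (∅ : Set F)) := by
    rw [Algebra.adjoin_empty]
    exact ⟨fun a => by
      obtain ⟨c, hc⟩ := Algebra.mem_bot.mp a.2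
      rw [show a = algebraMap k _ c from Subtype.ext hc.symm]
      exact isIntegral_algebraMap⟩
  exact isIntegral_trans w hw

end Integral

/-! ### Functions regular outside one point and their pole orders -/

section RegularOutside

variable {k F : Type*} [Field k] [Field F] [Algebra k F] {P : ValuationSubring F} {π : F}

variable (k) in
/-- The functions without poles outside `P`. -/
def regularOutside (P : ValuationSubring F) : Subalgebra k F where
  carrier := {w | ∀ O : ValuationSubring F, IsPlace k O → O ≠ P → w ∈ O}
  mul_mem' ha hb O hO hP := mul_mem (ha O hO hP) (hb O hO hP)
  add_mem' ha hb O hO hP := add_mem (ha O hO hP) (hb O hO hP)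
  algebraMap_mem' c _ hO _ := hO.1 c

/-- Such a `w` has no poles, so it is algebraic over `k`. If it were nonzero, its inverse would be
algebraic too, hence regular at `P`, against the vanishing of `w` there. -/
theorem eq_zero_of_mem_regularOutside (hP : IsPlace k P) {w : F} (hw : w ∈ regularOutside k P)
    (h : P.valuation w < 1) : w = 0 := by
  by_contra h0
  have hint : IsIntegral k w := isIntegral_of_forall_mem fun O hO => by
    by_cases hOP : O = P
    · rw [hOP]; exact (P.valuation_le_one_iff _).mp h.le
    · exact hw O hO hOP
  have hinv : IsIntegral k w⁻¹ := hint.inv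
  have hmem : w⁻¹ ∈ P := mem_of_isIntegral_adjoin (S := ∅)
    (hinv.tower_top (A := Algebra.adjoin k (∅ : Set F))) hP.1 (by simp)
  rw [← P.valuation_le_one_iff, map_inv₀,
    inv_le_one₀ (by simpa [zero_lt_iff] using h0)] at hmem
  exact absurd h (not_lt.mpr hmem)

/-- A space of functions regular outside `P` is spanned by functions realizing the possible
pole orders. -/
theorem mem_span_of_valuation_le (hP : IsPlace k P) (hπ : IsUniformizer P π)
    (hres : ∀ a ∈ P, ∃ c : k, P.valuation (a - algebraMap k F c) < 1)
    {S : Set ℕ} {φ : ℕ → F} (hφ : ∀ m ∈ S, φ m ∈ regularOutside k P ∧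
      P.valuation (φ m) = P.valuation π ^ (-(m : ℤ)))
    (hS : ∀ w ∈ regularOutside k P, ∀ m : ℕ, P.valuation w = P.valuation π ^ (-(m : ℤ)) → m ∈ S)
    (m : ℕ) {w : F} (hw : w ∈ regularOutside k P)
    (hwm : P.valuation w ≤ P.valuation π ^ (-(m : ℤ))) :
    w ∈ Submodule.span k (φ '' {s ∈ S | s ≤ m}) := by
  induction m using Nat.strong_induction_on generalizing w with
  | _ m ih =>
  rcases eq_or_ne w 0 with rfl | h0
  · exact zero_mem _
  obtain ⟨z, hz⟩ := hπ.exists_zpow w h0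
  by_cases hz0 : 0 < z
  · refine absurd (eq_zero_of_mem_regularOutside hP hw ?_) h0
    rwa [hz, ← zpow_zero (P.valuation π), hπ.zpow_lt_iff]
  obtain ⟨j, rfl⟩ : ∃ j : ℕ, z = -(j : ℤ) := ⟨(-z).toNat, by omega⟩
  have hjm : j ≤ m := by
    rw [hz, hπ.zpow_le_iff] at hwm
    omega
  have hjS := hS w hw j hz
  obtain ⟨hφR, hφj⟩ := hφ j hjS
  have hφ0 : φ j ≠ 0 := by
    intro h
    rw [h, map_zero] at hφj
    exact zpow_ne_zero _ hπ.pos.ne' hφj.symm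
  -- Subtracting `c • φ j`, with `c` the residue of `w / φ j`, lowers the pole order, and induction
  -- applies. For `j = 0` the difference vanishes at `P` and is therefore zero.
  obtain ⟨c, hc⟩ := hres (w / φ j) (by
    rw [← P.valuation_le_one_iff, map_div₀, hz, hφj, div_self (zpow_ne_zero _ hπ.pos.ne')])
  have hR : w - c • φ j ∈ regularOutside k P := sub_mem hw (Subalgebra.smul_mem _ hφR c)
  have hlt : P.valuation (w - c • φ j) < P.valuation π ^ (-(j : ℤ)) := by
    have : w - c • φ j = (w / φ j - algebraMap k F c) * φ j := by
      rw [Algebra.smul_def]; field_simp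
    rw [this, map_mul, ← hφj]
    exact mul_lt_of_lt_one_left (by simpa [zero_lt_iff] using hφ0) hc
  have hmem : w - c • φ j ∈ Submodule.span k (φ '' {s ∈ S | s ≤ m}) := by
    rcases Nat.eq_zero_or_pos j with rfl | hj
    · rw [eq_zero_of_mem_regularOutside hP hR (by simpa using hlt)]
      exact zero_mem _
    · have := ih (j - 1) (by omega) hR (by
        have := hπ.valuation_le_zpow_of_lt hlt
        rwa [show -(j : ℤ) + 1 = -((j - 1 : ℕ) : ℤ) by omega] at this)
      exact Submodule.span_mono (Set.image_mono fun s (hs : s ∈ S ∧ s ≤ j - 1) =>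
        (⟨hs.1, by omega⟩ : s ∈ S ∧ s ≤ m)) this
  have := add_mem hmem (Submodule.smul_mem _ c
    (Submodule.subset_span (Set.mem_image_of_mem φ (show j ∈ {s ∈ S | s ≤ m} from ⟨hjS, hjm⟩))))
  rwa [sub_add_cancel] at this

/-- If `d + 1` is not a pole order, then at most half of the numbers up to `d + 1` are. -/
theorem two_mul_finrank_le (hP : IsPlace k P) (hπ : IsUniformizer P π)
    (hres : ∀ a ∈ P, ∃ c : k, P.valuation (a - algebraMap k F c) < 1) (d : ℕ)
    (hd : ∀ w ∈ regularOutside k P, P.valuation w ≠ P.valuation π ^ (-((d + 1 : ℕ) : ℤ)))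
    (V : Submodule k F) (hV : ∀ w ∈ V, w ∈ regularOutside k P ∧
      P.valuation w ≤ P.valuation π ^ (-(d : ℤ))) :
    2 * Module.finrank k V ≤ d + 2 := by
  classical
  let S : Set ℕ := {m | ∃ w ∈ regularOutside k P, P.valuation w = P.valuation π ^ (-(m : ℤ))}
  have hex : ∀ m, ∃ w, m ∈ S → w ∈ regularOutside k P ∧
      P.valuation w = P.valuation π ^ (-(m : ℤ)) := by
    intro m
    by_cases hm : m ∈ S
    · obtain ⟨w, hw⟩ := hm
      exact ⟨w, fun _ => hw⟩
    · exact ⟨0, fun h => absurd h hm⟩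
  choose φ hφ using hex
  let T : Finset ℕ := (Finset.range (d + 2)).filter (· ∈ S)
  have hle : V ≤ Submodule.span k ((T.image φ : Finset F) : Set F) := by
    intro w hw
    refine Submodule.span_mono ?_ (mem_span_of_valuation_le hP hπ hres hφ
      (fun w hw m hm => ⟨w, hw, hm⟩) d (hV w hw).1 (hV w hw).2)
    rintro _ ⟨s, ⟨hs, hsd⟩, rfl⟩
    simp only [Finset.coe_image]
    exact ⟨s, by simp [T, hs]; omega, rfl⟩
  have hfin : Module.finrank k V ≤ T.card :=
    (Submodule.finrank_mono hle).trans
      ((finrank_span_finset_le_card _).trans Finset.card_image_le)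
  -- If `a` and `b = d + 1 - a` were both pole orders, the product of the corresponding functions
  -- would have pole order `d + 1`. So `T` and its reflection fit disjointly into `{0, …, d + 1}`.
  have hdisj : Disjoint T (T.image fun s => d + 1 - s) := by
    rw [Finset.disjoint_left]
    intro a ha hb
    obtain ⟨b, hb, hab⟩ := Finset.mem_image.mp hb
    simp only [T, Finset.mem_filter, Finset.mem_range] at ha hb
    obtain ⟨-, w, hw, hwv⟩ := ha
    obtain ⟨hbd, w', hw', hwv'⟩ := hb
    refine hd (w * w') (mul_mem hw hw') ?_
    rw [map_mul, hwv, hwv', ← zpow_add₀ hπ.pos.ne']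
    congr 1
    omega
  have hcard : (T.image fun s => d + 1 - s).card = T.card := by
    refine Finset.card_image_of_injOn fun a ha b hb hab => ?_
    simp only [T, Finset.coe_filter, Finset.mem_range, Set.mem_ofPred_eq] at ha hb hab
    omega
  have hsub : T ∪ (T.image fun s => d + 1 - s) ⊆ Finset.range (d + 2) := by
    refine Finset.union_subset (Finset.filter_subset _ _) fun a ha => ?_
    obtain ⟨b, -, rfl⟩ := Finset.mem_image.mp ha
    simp
    omega
  have := Finset.card_le_card hsub
  rw [Finset.card_union_of_disjoint hdisj, hcard, Finset.card_range] at this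
  omega

end RegularOutside

/-! ### Differentials as multiples of one differential -/

section Coordinate

variable {k F : Type*} [Field k] [Field F] [Algebra k F]

/-- `l` is the differential quotient `η ↦ η / dx`; composed with the universal derivation it is the
derivation `d/dx` of `F`. -/
theorem exists_coordinate (h : Module.rank F Ω[F⁄k] ≤ 1) {x : F}
    (hx : KaehlerDifferential.D k F x ≠ 0) :
    ∃ l : Ω[F⁄k] →ₗ[F] F, ∀ η, η = l η • KaehlerDifferential.D k F x := by
  obtain ⟨w, hw⟩ := rank_le_one_iff.mp h
  obtain ⟨a, ha⟩ := hw (KaehlerDifferential.D k F x)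
  have ha0 : a ≠ 0 := by
    rintro rfl
    exact hx (by rw [← ha, zero_smul])
  have hsurj : Function.Surjective
      (LinearMap.toSpanSingleton F Ω[F⁄k] (KaehlerDifferential.D k F x)) := by
    intro η
    obtain ⟨b, rfl⟩ := hw η
    exact ⟨b / a, by rw [LinearMap.toSpanSingleton_apply, ← ha, smul_smul, div_mul_cancel₀ _ ha0]⟩
  let e := LinearEquiv.ofBijective
    (LinearMap.toSpanSingleton F Ω[F⁄k] (KaehlerDifferential.D k F x))
    ⟨fun a b hab => smul_left_injective F hx hab, hsurj⟩
  exact ⟨e.symm.toLinearMap, fun η => (e.apply_symm_apply η).symm⟩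

/-- Regularity of a differential in terms of its coordinate. -/
theorem mem_regularDifferentialsAt_iff {l : Ω[F⁄k] →ₗ[F] F} (hl : Function.Injective l)
    {O : ValuationSubring F} {π : F} (hπ : π ∈ O)
    (hD : ∀ a ∈ O, O.valuation (l (KaehlerDifferential.D k F a)) ≤
      O.valuation (l (KaehlerDifferential.D k F π))) (η : Ω[F⁄k]) :
    η ∈ regularDifferentialsAt k O ↔
      O.valuation (l η) ≤ O.valuation (l (KaehlerDifferential.D k F π)) := by
  constructor
  · intro h
    unfold regularDifferentialsAt at h
    induction h using AddSubgroup.closure_induction with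
    | mem x hx =>
      obtain ⟨c, hc, a, ha, rfl⟩ := hx
      rw [map_smul, smul_eq_mul, map_mul]
      exact le_trans (mul_le_of_le_one_left' ((O.valuation_le_one_iff _).mpr hc)) (hD a ha)
    | zero => simp
    | add x y _ _ hx hy => rw [map_add]; exact O.valuation.map_add_le hx hy
    | neg x _ hx => rwa [map_neg, Valuation.map_neg]
  · intro h
    obtain ⟨c, hc⟩ := (O.valuation_le_iff _ _).mp h
    refine AddSubgroup.subset_closure ⟨c, c.2, π, hπ, hl ?_⟩
    rw [map_smul, smul_eq_mul, hc]

end Coordinate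

/-! ### The cover: canonical divisor, genus and holomorphy -/

namespace IsHKGCover

variable {k F : Type*} [Field k] [Field F] [Algebra k F] {r : ℕ}
  {p : ℕ} {P : ValuationSubring F} {f : Fin (r + 1) → F}

/-- Otherwise `f 0` would have no pole at all and be algebraic over `k`. Hence `P` lies over
infinity, where `(f 0)⁻¹` is the local parameter of the line. -/
theorem generator_notMem (hX : IsHKGCover (k := k) p P f) : f 0 ∉ P := by
  intro h
  refine hX.transcendental (isIntegral_of_forall_mem fun O hO => ?_).isAlgebraic
  by_cases hOP : O = P
  · rwa [hOP]
  · exact hX.regular 0 O hO hOP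

theorem generator_ne_zero (hX : IsHKGCover (k := k) p P f) : f 0 ≠ 0 := fun h =>
  hX.generator_notMem (h ▸ zero_mem P)

theorem valuation_generator_inv_lt_one (hX : IsHKGCover (k := k) p P f) :
    P.valuation (f 0)⁻¹ < 1 := by
  rw [map_inv₀, inv_lt_one₀ (by simpa [zero_lt_iff] using hX.generator_ne_zero)]
  exact not_le.mp ((P.valuation_le_one_iff _).not.mpr hX.generator_notMem)

theorem adjoin_generator_inv (f : Fin (r + 1) → F) : k⟮f 0⟯ = k⟮(f 0)⁻¹⟯ := by
  refine le_antisymm ?_ ?_ <;> rw [IntermediateField.adjoin_simple_le_iff]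
  · rw [← inv_inv (f 0)]
    exact inv_mem (by rw [inv_inv]; exact IntermediateField.mem_adjoin_simple_self k _)
  · exact inv_mem (IntermediateField.mem_adjoin_simple_self k _)

theorem adjoin_generator_sub (f : Fin (r + 1) → F) (c : k) :
    k⟮f 0⟯ = k⟮f 0 - algebraMap k F c⟯ := by
  refine le_antisymm ?_ ?_ <;> rw [IntermediateField.adjoin_simple_le_iff]
  · have := add_mem (IntermediateField.mem_adjoin_simple_self k (f 0 - algebraMap k F c))
      (algebraMap_mem k⟮f 0 - algebraMap k F c⟯ c)
    rwa [sub_add_cancel] at this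
  · exact sub_mem (IntermediateField.mem_adjoin_simple_self k _) (algebraMap_mem _ c)

/-- The structure of the local ring at the totally ramified point. -/
theorem structure_at [IsAlgClosed k] (hX : IsHKGCover (k := k) p P f) :
    IsDiscreteValuationRing P ∧
      (∀ a ∈ P, ∃ c : k, P.valuation (a - algebraMap k F c) < 1) ∧
      ∀ D : Derivation k F F, ∃ s : F, s ≠ 0 ∧ ∀ a ∈ P, s * D a ∈ P := by
  have := hX.finite
  have := hX.isGalois
  have hE := adjoin_generator_inv (k := k) f
  have h1 : FiniteDimensional k⟮(f 0)⁻¹⟯ F := hE ▸ hX.finite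
  have h2 : Algebra.IsSeparable k⟮(f 0)⁻¹⟯ F := by
    rw [← hE]; infer_instance
  exact hX.isPlace.isDiscreteValuationRing
    ((P.valuation_le_one_iff _).mp hX.valuation_generator_inv_lt_one.le)
    (fun h => hX.transcendental (by simpa using h.inv))

/-- At the unramified points, derivations of `F` are determined by their value at `f₀`. -/
theorem exists_uniformizer_of_ne [IsAlgClosed k] (hX : IsHKGCover (k := k) p P f)
    {O : ValuationSubring F} (hO : IsPlace k O) (hOP : O ≠ P) :
    ∃ π ∈ O, ∀ D : Derivation k F F, D π = D (f 0) ∧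
      ∀ a ∈ O, O.valuation (D a) ≤ O.valuation (D π) := by
  have := hX.finite
  have := hX.isGalois
  obtain ⟨hdvr, hres, hD⟩ := hO.isDiscreteValuationRing (hX.regular 0 O hO hOP) hX.transcendental
  obtain ⟨c, hc⟩ := hres _ (hX.regular 0 O hO hOP)
  have h0 : f 0 - algebraMap k F c ≠ 0 := fun h =>
    hX.transcendental (sub_eq_zero.mp h ▸ isAlgebraic_algebraMap c)
  obtain ⟨ϖ, hϖ⟩ := exists_isUniformizer O
  -- With ramification index `1`, the local parameter `f 0 - c` of the line is also a uniformizer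
  -- upstairs, and derivations do not see the constant `c`.
  have hv := (hX.unramified O hO hOP).valuation_eq_pow (adjoin_generator_sub f c) hO.1 hc h0 hϖ
  rw [pow_one] at hv
  have hu : IsUniformizer O (f 0 - algebraMap k F c) := ⟨h0, hc, fun w hw => hv ▸ hϖ.exists_zpow w hw⟩
  refine ⟨_, (O.valuation_le_one_iff _).mp hc.le, fun D => ⟨?_, fun a ha => ?_⟩⟩
  · rw [map_sub, D.map_algebraMap, sub_zero]
  · exact hu.valuation_derivation_le hO.1 hres D (hD D) ha

theorem valuation_generator_inv (hX : IsHKGCover (k := k) p P f) {π : F}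
    (hπ : IsUniformizer P π) :
    P.valuation (f 0)⁻¹ = P.valuation π ^ Module.finrank k⟮f 0⟯ F :=
  hX.totally_ramified.valuation_eq_pow (adjoin_generator_inv f) hX.isPlace.1
    hX.valuation_generator_inv_lt_one (inv_ne_zero hX.generator_ne_zero) hπ

open IntermediateField.algebraAdjoinAdjoin in
/-- There is no differential whose only pole is a simple pole at `P`. -/
theorem valuation_mul_ne (hX : IsHKGCover (k := k) p P f) {π : F} (hπ : IsUniformizer P π)
    (D : Derivation k F F) (hD : D (f 0) = 1) {w : F} (hw : w ∈ regularOutside k P) :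
    P.valuation (w * π) ≠ P.valuation (D π) := by
  intro hwv
  have := hX.finite
  have := hX.isGalois
  have hEt := adjoin_generator_inv (k := k) f
  have ht := hX.valuation_generator_inv hπ
  have hx0 := hX.generator_ne_zero
  set t := (f 0)⁻¹ with htdef
  set n := Module.finrank k⟮f 0⟯ F with hn
  have ht0 : t ≠ 0 := inv_ne_zero hx0
  have hpos : 0 < n := Module.finrank_pos
  have hDt : D t = -t ^ 2 := by
    rw [htdef, D.leibniz_inv, hD]; simp
  have hDt0 : D t ≠ 0 := by rw [hDt]; simpa using ht0
  have hδ := hπ.valuation_derivative_minpoly_mul hX.isPlace.1 hEt ht D hDt0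
  have htr := hπ.valuation_trace (exists_valuation_eq_zpow_finrank hX.isPlace.1 hEt ht hπ)
    (hEt ▸ IntermediateField.mem_adjoin_simple_self k t) ht0 (h := w) (by
      have hvπ : P.valuation π ≠ 0 := hπ.pos.ne'
      refine mul_right_cancel₀ hvπ ?_
      rw [← map_mul, mul_right_comm, map_mul, hwv, ← map_mul, mul_comm, hδ, hDt, Valuation.map_neg,
        ← map_mul, mul_assoc, ← pow_succ, Nat.sub_add_cancel hpos, map_mul, map_pow, map_pow, ← ht,
        pow_two])
  -- Since `f 0 ∉ P`, regularity outside `P` gives integrality over `k[f₀]`. The trace inherits it,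
  -- so it is regular outside `P`; having the valuation of `t` it vanishes at `P`, hence is zero,
  -- although `t ≠ 0`.
  have hint : IsIntegral (Algebra.adjoin k {f 0}) w := isIntegral_adjoin_of_forall_mem
    fun O hO hfO => by
      by_cases htop : O = ⊤
      · rw [htop]; trivial
      · refine hw O ⟨hO, htop⟩ ?_
        rintro rfl
        exact hX.generator_notMem (hfO _ rfl)
  have hinttr : IsIntegral (Algebra.adjoin k {f 0}) (Algebra.trace k⟮f 0⟯ F w : F) :=
    (Algebra.isIntegral_trace (L := k⟮f 0⟯) hint).algebraMap
  have hmem : (Algebra.trace k⟮f 0⟯ F w : F) ∈ regularOutside k P := fun O hO hOP =>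
    mem_of_isIntegral_adjoin hinttr hO.1 fun s hs => by
      rw [Set.mem_singleton_iff.mp hs]; exact hX.regular 0 O hO hOP
  have h0 := eq_zero_of_mem_regularOutside hX.isPlace hmem
    (htr ▸ hX.valuation_generator_inv_lt_one)
  rw [h0, map_zero] at htr
  exact ht0 (P.valuation.zero_iff.mp htr.symm)

/-- The degree of a canonical divisor bounds the genus: `2 g - 2 ≤ d` if `dπ` has a pole of order
`d` with respect to `df₀`. -/
theorem genus_le [IsAlgClosed k] (hX : IsHKGCover (k := k) p P f) {π : F}
    (hπ : IsUniformizer P π) {l : Ω[F⁄k] →ₗ[F] F} (hl : Function.Injective l)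
    (hl1 : l (KaehlerDifferential.D k F (f 0)) = 1) {d : ℤ}
    (hd : P.valuation (l (KaehlerDifferential.D k F π)) = P.valuation π ^ (-d)) :
    genus k F = 0 ∨ 2 * (genus k F : ℤ) - 2 ≤ d := by
  obtain ⟨hdvr, hres, hbd⟩ := hX.structure_at
  let D : Derivation k F F := l.compDer (KaehlerDifferential.D k F)
  let l' : Ω[F⁄k] →ₗ[k] F := l.restrictScalars k
  let V : Submodule k F := (holomorphicDifferentials k F).map l'
  have hV : ∀ w ∈ V, w ∈ regularOutside k P ∧ P.valuation w ≤ P.valuation π ^ (-d) := by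
    rintro _ ⟨η, hη, rfl⟩
    refine ⟨fun O hO hOP => ?_, ?_⟩
    · obtain ⟨ϖ, hϖ, H⟩ := hX.exists_uniformizer_of_ne hO hOP
      have := (mem_regularDifferentialsAt_iff hl hϖ (H D).2 η).mp (hη O hO)
      rw [show l (KaehlerDifferential.D k F ϖ) = 1 from (H D).1.trans hl1, map_one] at this
      exact (O.valuation_le_one_iff _).mp this
    · rw [← hd]
      exact (mem_regularDifferentialsAt_iff hl ((P.valuation_le_one_iff π).mp hπ.lt_one.le)
        (fun a ha => hπ.valuation_derivation_le hX.isPlace.1 hres D (hbd D) ha) η).mp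
        (hη P hX.isPlace)
  have hgenus : genus k F = Module.finrank k V :=
    (Submodule.equivMapOfInjective l' hl (holomorphicDifferentials k F)).finrank_eq
  rcases lt_or_ge d 0 with hd0 | hd0
  -- For `d < 0` this argument yields only `g = 0`, not the inequality; hence the disjunction in the
  -- conclusion.
  · left
    have : V = ⊥ := by
      rw [eq_bot_iff]
      intro w hw
      refine eq_zero_of_mem_regularOutside hX.isPlace (hV w hw).1
        (lt_of_le_of_lt (hV w hw).2 ?_)
      rw [← zpow_zero (P.valuation π), hπ.zpow_lt_iff]
      omega
    rw [hgenus, this, finrank_bot]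
  · right
    lift d to ℕ using hd0
    -- A function `w` with pole order `d + 1` would give `w df₀` a simple pole at `P` and no other
    -- pole.
    have := two_mul_finrank_le hX.isPlace hπ hres d (fun w hw hwv => by
      refine hX.valuation_mul_ne hπ D hl1 hw ?_
      rw [map_mul, hwv, show D π = l (KaehlerDifferential.D k F π) from rfl, hd,
        ← zpow_add_one₀ hπ.pos.ne']
      congr 1
      push_cast
      ring) V hV
    rw [← hgenus] at this
    omega

/-- The factor `f 0` contributes its exact pole order `|G|`, by total ramification; the other
factors are bounded through `poleOrder_spec`. -/
theorem valuation_prod_le (hX : IsHKGCover (k := k) p P f) {π : F} (hπ : IsUniformizer P π)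
    (L : Fin (r + 1) → ℕ) :
    P.valuation (∏ i, f i ^ L i) ≤ P.valuation π ^ (-(norm k P f L : ℤ)) := by
  have := hX.isGalois
  have := hX.finite
  have h0 : P.valuation (f 0) = P.valuation π ^ (-(Nat.card Gal(F/k⟮f 0⟯) : ℤ)) := by
    have := hX.valuation_generator_inv hπ
    rw [map_inv₀, inv_eq_iff_eq_inv] at this
    rw [IsGalois.card_aut_eq_finrank, this, zpow_neg, zpow_natCast]
  have hprod : ∀ s : Finset (Fin r), P.valuation (∏ ν ∈ s, f ν.succ ^ L ν.succ) ≤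
      P.valuation π ^ (-((∑ ν ∈ s, L ν.succ * poleOrder P (f ν.succ) : ℕ) : ℤ)) := by
    intro s
    induction s using Finset.cons_induction with
    | empty => simp
    | cons a s ha ih =>
      rw [Finset.prod_cons, Finset.sum_cons, map_mul, Nat.cast_add, neg_add,
        zpow_add₀ hπ.pos.ne']
      refine mul_le_mul' ?_ ih
      rw [map_pow, Nat.cast_mul, mul_comm, ← neg_mul, zpow_mul, zpow_natCast]
      exact pow_le_pow_left' (hπ.poleOrder_spec _) _
  rw [Fin.prod_univ_succ, norm, map_mul, Nat.cast_add, neg_add, zpow_add₀ hπ.pos.ne']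
  refine mul_le_mul' (le_of_eq ?_) (hprod _)
  rw [map_pow, h0, Nat.cast_mul, mul_comm, ← neg_mul, zpow_mul, zpow_natCast]

theorem omega_mem [IsAlgClosed k] (hX : IsHKGCover (k := k) p P f) (L : Fin (r + 1) → ℕ)
    (hL : L ∈ indexSet k P f) : omega k f L ∈ holomorphicDifferentials k F := by
  intro O hO
  by_cases hOP : O ≠ P
  · exact AddSubgroup.subset_closure ⟨_, prod_mem fun i _ => pow_mem (hX.regular i O hO hOP) _,
      f 0, hX.regular 0 O hO hOP, rfl⟩
  obtain rfl : O = P := not_not.mp hOP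
  by_cases hx : KaehlerDifferential.D k F (f 0) = 0
  · rw [omega, hx, smul_zero]
    exact zero_mem _
  obtain ⟨l, hl⟩ := exists_coordinate hX.rank_le_one hx
  have hinj : Function.Injective l := fun a b hab => by rw [hl a, hl b, hab]
  have hl1 : l (KaehlerDifferential.D k F (f 0)) = 1 := by
    have := hl (KaehlerDifferential.D k F (f 0))
    conv_lhs at this => rw [← one_smul F (KaehlerDifferential.D k F (f 0))]
    exact (smul_left_injective F hx this).symm
  obtain ⟨hdvr, hres, hbd⟩ := hX.structure_at
  obtain ⟨π, hπ⟩ := exists_isUniformizer O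
  let D : Derivation k F F := l.compDer (KaehlerDifferential.D k F)
  have hDle : ∀ a ∈ O, O.valuation (D a) ≤ O.valuation (D π) := fun a ha =>
    hπ.valuation_derivation_le hX.isPlace.1 hres D (hbd D) ha
  -- `D π` dominates the derivative of every regular function, in particular that of `(f 0)⁻¹`,
  -- which is `-(f 0)⁻¹ ^ 2 ≠ 0`.
  have hDπ : D π ≠ 0 := by
    intro h0
    have := hDle _ ((O.valuation_le_one_iff _).mp hX.valuation_generator_inv_lt_one.le)
    rw [h0, map_zero, le_zero_iff, map_eq_zero, D.leibniz_inv,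
      show D (f 0) = 1 from hl1] at this
    simp [hX.generator_ne_zero] at this
  obtain ⟨z, hz⟩ := hπ.exists_zpow _ hDπ
  obtain ⟨d, rfl⟩ : ∃ d : ℤ, z = -d := ⟨-z, by ring⟩
  rw [mem_regularDifferentialsAt_iff hinj ((O.valuation_le_one_iff π).mp hπ.lt_one.le) hDle,
    omega, map_smul, hl1, smul_eq_mul, mul_one]
  refine le_trans (hX.valuation_prod_le hπ L) (le_of_le_of_eq ?_ hz.symm)
  rw [hπ.zpow_le_iff]
  have hL' : (norm k O f L : ℤ) ≤ 2 * (genus k F : ℤ) - 2 := hL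
  -- In genus zero the bound `‖L‖ ≤ -2` is impossible, so that case is vacuous.
  rcases hX.genus_le hπ hinj hl1 hz with hg | hg <;> omega

end IsHKGCover

/-! ### The binomial relations -/

theorem toPolydifferentials_omega_mul {k F : Type*} [Field k] [Field F] [Algebra k F] {r : ℕ}
    {f : Fin (r + 1) → F} (L K : Fin (r + 1) → ℕ)
    (hL : omega k f L ∈ holomorphicDifferentials k F)
    (hK : omega k f K ∈ holomorphicDifferentials k F) :
    ((toPolydifferentials k F ⟨omega k f L, hL⟩ : TensorAlgebra F Ω[F⁄k]) *
      (toPolydifferentials k F ⟨omega k f K, hK⟩ : TensorAlgebra F Ω[F⁄k])) =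
      (∏ i, f i ^ (L + K) i) • (TensorAlgebra.ι F (KaehlerDifferential.D k F (f 0)) *
        TensorAlgebra.ι F (KaehlerDifferential.D k F (f 0))) := by
  change TensorAlgebra.ι F (omega k f L) * TensorAlgebra.ι F (omega k f K) = _
  rw [omega, omega, map_smul, map_smul, smul_mul_smul_comm, ← Finset.prod_mul_distrib]
  simp only [Pi.add_apply, pow_add]

end HKG

end

theorem proposition4p1 {k F : Type*} [Field k] [IsAlgClosed k] [Field F] [Algebra k F]
    (p : ℕ) [Fact p.Prime] [CharP k p] (r : ℕ)
    (P : ValuationSubring F) (f : Fin (r + 1) → F) (hX : HKG.IsHKGCover (k := k) p P f) :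
    ∃ h : ∀ L ∈ HKG.indexSet k P f, HKG.omega k f L ∈ HKG.holomorphicDifferentials k F,
      HKG.binomials h ⊆ (HKG.canonicalIdeal hX.rank_le_one : Set _) := by
  refine ⟨hX.omega_mem, ?_⟩
  rintro _ ⟨L, K, L', K', hsum, rfl⟩
  change HKG.canonicalMap hX.rank_le_one _ = 0
  rw [map_sub, map_mul, map_mul, sub_eq_zero, HKG.canonicalMap_ι, HKG.canonicalMap_ι,
    HKG.canonicalMap_ι, HKG.canonicalMap_ι, DirectSum.of_mul_of, DirectSum.of_mul_of]
  -- Both products lie in degree `1 + 1`, so the equality reduces to one of tensors, each depending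
  -- only on its exponent sum.
  congr 1
  refine Subtype.ext ?_
  refine (HKG.toPolydifferentials_omega_mul _ _ _ _).trans
    (Eq.trans ?_ (HKG.toPolydifferentials_omega_mul _ _ _ _).symm)
  rw [hsum]
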